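/- **Theorem.** Let $q\in(2,\infty)$. Throughout, $|\cdot|$ is the Euclidean norm and $\operatorname{diam}$ the Euclidean diameter. (a) Let $\mathbb S$ be the unit sphere of $\mathbb R^3$ with its surface measure, and let $\Phi\colon\mathbb R^3\to\mathbb R^3$ be a bi-Lipschitz map of $\mathbb R^3$ onto itself that takes the cube $[0,1]^3$ onto the closed unit ball. For $k\ge 1$ let $\tilde{\mathcal D}_k$ be the collection of the sets $\Phi(Q)\subset\mathbb S$, where $Q$ runs through the $6\cdot 2^{2k}$ closed squares of side length $2^{-k}$ that are obtained by dividing each of the six faces of $[0,1]^3$ into $2^{2k}$ equal dyadic squares. Then a homeomorphism $\varphi$ of $\mathbb S$ onto $\mathbb S$ satisfies $$\int_{\mathbb S}\int_{\mathbb S}\frac{|\varphi(x)-\varphi(y)|^q}{|x-y|^{q+1}}\,dx\,dy<\infty$$ (that is, its Gagliardo $W^{1-1/q,q}$ seminorm is finite) if and only if $$\sum_{k=1}^\infty 2^{k(q-3)}\sum_{\tilde Q\in\tilde{\mathcal D}_k}\big[\operatorname{diam}\varphi(\tilde Q)\big]^q<\infty .$$ (b) Let $\varphi$ be a homeomorphism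 of $\mathbb R^2$ onto $\mathbb R^2$. For $R>0$ let $\mathbb I_R=[-R,R]^2$, and for integers $N,k\ge 1$ let $\tilde{\mathcal D}^N_k$ be the collection of the $2^{2k}$ closed dyadic squares of side length $2N\cdot 2^{-k}$ into which $\mathbb I_N$ is divided. Then $$\int_{\mathbb I_R}\int_{\mathbb I_R}\frac{|\varphi(x)-\varphi(y)|^q}{|x-y|^{q+1}}\,dx\,dy<\infty\quad\text{for every }R>0$$ if and only if $$\sum_{k=1}^\infty 2^{k(q-3)}\sum_{\tilde Q\in\tilde{\mathcal D}^N_k}\big[\operatorname{diam}\varphi(\tilde Q)\big]^q<\infty\quad\text{for every integer }N\ge 1 .$$ -/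

import Mathlib

open MeasureTheory Set
open scoped ENNReal

/-- The Gagliardo double integral
`∫ ∫ |φ x - φ y| ^ q / |x - y| ^ (q + 1) dμ(x) dμ(y)`
over a two-dimensional domain with measure `μ`; it is the `q`-th power of the
`W^{1 - 1/q, q}` seminorm, since `q + 1 = 2 + (1 - 1/q) q`.
The integrand is nonnegative and the integral takes values in `[0, ∞]`. -/
noncomputable def gagliardoEnergy {X Y : Type*} [MetricSpace X] [MeasurableSpace X]
    [MetricSpace Y] (μ : Measure X) (q : ℝ) (φ : X → Y) : ℝ≥0∞ :=
  ∫⁻ x, ∫⁻ y, ENNReal.ofReal (dist (φ x) (φ y) ^ q / dist x y ^ (q + 1)) ∂μ ∂μ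

/-- The sum `∑_{k ≥ 1} 2 ^ (k (q - 3)) ∑_j (diam φ(Q k j)) ^ q`, with values in `[0, ∞]`,
for a sequence of finite families `Q k` of sets. -/
noncomputable def diameterSum {X Y : Type*} [MetricSpace Y] {ι : ℕ → Type}
    [∀ k, Fintype (ι k)] (Q : ∀ k, ι k → Set X) (q : ℝ) (φ : X → Y) : ℝ≥0∞ :=
  ∑' k : {k : ℕ // 1 ≤ k}, (2 : ℝ≥0∞) ^ ((k.1 : ℝ) * (q - 3)) *
    ∑ j : ι k.1, Metric.ediam (φ '' Q k.1 j) ^ q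

/-- The square `[-R, R]²`. -/
def planeSquare (R : ℝ) : Set (EuclideanSpace ℝ (Fin 2)) :=
  {x | ∀ i, x i ∈ Icc (-R) R}

/-- The closed dyadic squares of generation `k` of `[-R, R]²`; the square with index `m`
is the product of the intervals `[-R + 2R m_i / 2^k, -R + 2R (m_i + 1) / 2^k]`. -/
def planeDyadicSquare (R : ℝ) (k : ℕ) (m : Fin 2 → Fin (2 ^ k)) :
    Set (EuclideanSpace ℝ (Fin 2)) :=
  {x | ∀ i, x i ∈ Icc (-R + 2 * R * (((m i : ℕ) : ℝ) / 2 ^ k))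
    (-R + 2 * R * ((((m i : ℕ) : ℝ) + 1) / 2 ^ k))}

/-- The unit cube `[0, 1]³`. -/
def unitCube : Set (EuclideanSpace ℝ (Fin 3)) :=
  {x | ∀ i, x i ∈ Icc (0 : ℝ) 1}

/-- The closed dyadic squares of generation `k` of the boundary of the unit cube.
The index `(i, s, m)` stands for the square with index `m` in the face `x i = s`,
where `s` is `0` or `1`. -/
def cubeDyadicSquare (k : ℕ) (j : Fin 3 × Fin 2 × (Fin 2 → Fin (2 ^ k))) :
    Set (EuclideanSpace ℝ (Fin 3)) :=
  {x | x j.1 = ((j.2.1 : ℕ) : ℝ) ∧ ∀ l : Fin 2, x (j.1.succAbove l) ∈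
    Icc (((j.2.2 l : ℕ) : ℝ) / 2 ^ k) ((((j.2.2 l : ℕ) : ℝ) + 1) / 2 ^ k)}

/-- The unit sphere of three-dimensional Euclidean space. -/
abbrev UnitSphere : Type :=
  Metric.sphere (0 : EuclideanSpace ℝ (Fin 3)) 1

/-- `Φ` is a bi-Lipschitz map of the metric space `X` onto `Y`: a bijection with
`c |x - y| ≤ |Φ x - Φ y| ≤ C |x - y|` for some constants `c, C > 0`. -/
def IsBiLipschitz {X Y : Type*} [MetricSpace X] [MetricSpace Y] (Φ : X → Y) : Prop :=
  Function.Bijective Φ ∧ ∃ c C : ℝ, 0 < c ∧ 0 < C ∧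
    ∀ x y, c * dist x y ≤ dist (Φ x) (Φ y) ∧ dist (Φ x) (Φ y) ≤ C * dist x y

/-- The members `Φ(Q)` of the `k`-th generation dyadic decomposition of the sphere that
is induced by `Φ`, where `Q` runs through the `k`-th generation dyadic squares of the
boundary of the unit cube, as subsets of the sphere. -/
def sphereDyadicSquare (Φ : EuclideanSpace ℝ (Fin 3) → EuclideanSpace ℝ (Fin 3)) (k : ℕ)
    (j : Fin 3 × Fin 2 × (Fin 2 → Fin (2 ^ k))) : Set UnitSphere :=
  Subtype.val ⁻¹' (Φ '' cubeDyadicSquare k j)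

/-! Both equivalences are instances of two implications on a space whose balls of radius r have
measure comparable to r². The cubical charts enter only through `IsDyadicCovering`: sets of
generation k have size O(2⁻ᵏ) and bounded overlap.

From the sum to the integral (`gagliardoEnergy_lt_top_of_diameterSum_lt_top`): if |x - y| is about
2⁻ᵏ, a connected set joins x to y inside boundedly many sets of generation k, so |φ x - φ y| is at
most the sum of the diameters of their images. The kernel costs 2^(k(q+1)), and integrating x and y
over balls of radius O(2⁻ᵏ) gains 2^(-4k); what remains is the weight 2^(k(q-3)).

From the integral to the sum (`diameterSum_lt_top_of_gagliardoEnergy_lt_top`): pointwise oscillation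
is not controlled by a mean, but topology helps. A small set in the target is no wider than its
frontier (`ediam_le_ediam_frontier`), so the image of a small ball of radius 2⁻ᵏ is no wider than
the image of every concentric sphere of radius t in [2⁻ᵏ, 2·2⁻ᵏ]. Points of such a sphere are
reached by telescoping through shrinking balls (`ediam_image_sphere_rpow_le`). At scale 2^(-(k+i))
these balls stay in a thin annulus around the sphere, and averaging over t gains the factor 2⁻ⁱ
(`ediam_image_closedBall_rpow_le`). Summing over all squares and scales, this gain yields geometric
decay in i with rate q - 2, which is where q > 2 is needed; the remaining sum over scales is bounded
by the Gagliardo integral (`tsum_lintegral_ballEnergy_le`). -/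

/-! ### Chains of sets, power sums and dyadic scales -/

open Metric in
/-- If a preconnected set is covered by finitely many sets, then the distance between the images
of two of its points is at most the sum of the diameters of the images of the covering sets. -/
theorem edist_le_sum_ediam_of_isPreconnected {X Y ι : Type*} [TopologicalSpace X] [MetricSpace Y]
    {s : Finset ι} {F : ι → Set X} {K : Set X} (hK : IsPreconnected K)
    (hcov : K ⊆ ⋃ i ∈ s, F i) {f : X → Y} (hf : Continuous f) {x y : X} (hx : x ∈ K)
    (hy : y ∈ K) : edist (f x) (f y) ≤ ∑ i ∈ s, ediam (f '' F i) := by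
  -- The distance from `f x` reduces the claim to the real line: the image of `K` contains an
  -- interval of length |f x - f y|, and the outer measure of a set of reals is at most its
  -- diameter.
  set g : X → ℝ := fun z => dist (f x) (f z) with hg
  have hgc : Continuous g := continuous_const.dist hf
  have hsub : Icc (g x) (g y) ⊆ ⋃ i ∈ s, g '' F i := by
    have h1 : Icc (g x) (g y) ⊆ g '' K :=
      (hK.image g hgc.continuousOn).Icc_subset (mem_image_of_mem g hx) (mem_image_of_mem g hy)
    refine h1.trans ((image_mono hcov).trans ?_)
    simp only [image_iUnion]
    exact subset_rfl
  have hlip : ∀ i, ediam (g '' F i) ≤ ediam (f '' F i) := by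
    intro i
    have : g '' F i = (fun w => dist (f x) w) '' (f '' F i) := by rw [image_image]
    rw [this]
    simpa using (LipschitzWith.dist_right (f x)).ediam_image_le (f '' F i)
  calc edist (f x) (f y) = volume (Icc (g x) (g y)) := by
        rw [Real.volume_Icc, edist_dist]; simp [hg]
    _ ≤ volume (⋃ i ∈ s, g '' F i) := measure_mono hsub
    _ ≤ ∑ i ∈ s, volume (g '' F i) := measure_biUnion_finset_le _ _
    _ ≤ ∑ i ∈ s, ediam (f '' F i) :=
        Finset.sum_le_sum fun i _ => (Real.volume_le_diam _).trans (hlip i)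

/-- Each term is at most the ℓ^q norm of the family. The constant is not the sharp one from Hölder,
but only boundedly many terms are ever summed. -/
theorem ENNReal.sum_rpow_le_card_rpow_mul_sum {ι : Type*} (s : Finset ι) (f : ι → ℝ≥0∞) {q : ℝ}
    (hq : 0 < q) : (∑ i ∈ s, f i) ^ q ≤ (s.card : ℝ≥0∞) ^ q * ∑ i ∈ s, f i ^ q := by
  have h : ∀ i ∈ s, f i ≤ (∑ i ∈ s, f i ^ q) ^ q⁻¹ := fun i hi => by
    rw [ENNReal.le_rpow_inv_iff hq]
    exact Finset.single_le_sum (f := fun i => f i ^ q) (fun _ _ => zero_le) hi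
  calc (∑ i ∈ s, f i) ^ q ≤ (s.card • (∑ i ∈ s, f i ^ q) ^ q⁻¹) ^ q :=
        ENNReal.rpow_le_rpow (Finset.sum_le_card_nsmul _ _ _ h) hq.le
    _ = _ := by
        rw [nsmul_eq_mul, ENNReal.mul_rpow_of_nonneg _ _ hq.le, ENNReal.rpow_inv_rpow hq.ne']

theorem ENNReal.ofReal_two_inv_pow (k : ℕ) :
    ENNReal.ofReal ((2⁻¹ : ℝ) ^ k) = (2 : ℝ≥0∞) ^ (-(k : ℝ)) := by
  rw [ENNReal.rpow_neg, ENNReal.rpow_natCast, inv_pow, ENNReal.ofReal_inv_of_pos (by positivity),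
    ENNReal.ofReal_pow (by norm_num)]
  simp

theorem ENNReal.two_rpow_add (a b : ℝ) : (2 : ℝ≥0∞) ^ (a + b) = 2 ^ a * 2 ^ b :=
  ENNReal.rpow_add _ _ (by norm_num) (by norm_num)

theorem ofReal_dist_rpow_div {X Y : Type*} [MetricSpace X] [MetricSpace Y] {q : ℝ} (hq : 0 < q)
    (φ : X → Y) (x y : X) :
    ENNReal.ofReal (dist (φ x) (φ y) ^ q / dist x y ^ (q + 1)) =
      edist (φ x) (φ y) ^ q * ENNReal.ofReal (dist x y ^ (-(q + 1))) := by
  rw [div_eq_mul_inv, ← Real.rpow_neg dist_nonneg, ENNReal.ofReal_mul (by positivity),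
    edist_dist, ENNReal.ofReal_rpow_of_nonneg dist_nonneg hq.le]

theorem ofReal_two_inv_pow_rpow_neg (k : ℕ) (s : ℝ) :
    ENNReal.ofReal (((2⁻¹ : ℝ) ^ k) ^ (-s)) = (2 : ℝ≥0∞) ^ ((k : ℝ) * s) := by
  rw [← ENNReal.ofReal_rpow_of_pos (by positivity), ENNReal.ofReal_two_inv_pow,
    ← ENNReal.rpow_mul]
  congr 1
  ring

theorem ofReal_dist_rpow_div_le {X Y : Type*} [MetricSpace X] [MetricSpace Y] {q : ℝ} (hq : 0 < q)
    (φ : X → Y) {x y : X} {k : ℕ} (h : (2⁻¹ : ℝ) ^ k ≤ dist x y) :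
    ENNReal.ofReal (dist (φ x) (φ y) ^ q / dist x y ^ (q + 1)) ≤
      edist (φ x) (φ y) ^ q * (2 : ℝ≥0∞) ^ ((k : ℝ) * (q + 1)) := by
  rw [ofReal_dist_rpow_div hq, ← ofReal_two_inv_pow_rpow_neg]
  exact mul_le_mul_right (ENNReal.ofReal_le_ofReal
    (Real.rpow_le_rpow_of_nonpos (by positivity) h (by linarith))) _

theorem exists_two_inv_pow_lt_le {d : ℝ} (h0 : 0 < d) (h1 : d ≤ 2⁻¹) :
    ∃ k : ℕ, 1 ≤ k ∧ (2⁻¹ : ℝ) ^ (k + 1) < d ∧ d ≤ 2⁻¹ ^ k := by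
  obtain ⟨n, hn, hn'⟩ := exists_nat_pow_near_of_lt_one (y := (2⁻¹ : ℝ)) h0 (by linarith)
    (by norm_num) (by norm_num)
  rcases Nat.eq_zero_or_pos n with rfl | hpos
  · simp only [zero_add, pow_one] at hn
    linarith
  · exact ⟨n, hpos, hn, hn'⟩

/-! ### From the diameter sum to the Gagliardo integral -/

/-- A sequence of finite coverings of `Ω` by subsets of `Ω`, with the geometry of the dyadic
squares: the sets of generation `k` have diameter `O(2⁻ᵏ)`, and a ball with radius `O(2⁻ᵏ)` meets
boundedly many of them. -/
structure IsDyadicCovering {X : Type*} [MetricSpace X] {ι : ℕ → Type} (Ω : Set X)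
    (Q : ∀ k, ι k → Set X) (p : ∀ k, ι k → X) : Prop where
  subset : ∀ k j, Q k j ⊆ Ω
  center_mem : ∀ k j, p k j ∈ Q k j
  exists_subset_closedBall :
    ∃ D : ℝ, 0 ≤ D ∧ ∀ k j, Q k j ⊆ Metric.closedBall (p k j) (D * 2⁻¹ ^ k)
  exists_mem : ∀ k, ∀ x ∈ Ω, ∃ j, x ∈ Q k j
  exists_ncard_le : ∀ A : ℝ, ∃ M : ℕ, ∀ k x,
    {j | (Q k j ∩ Metric.closedBall x (A * 2⁻¹ ^ k)).Nonempty}.ncard ≤ M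

open Metric in
/-- The Gagliardo integral of a continuous map is finite if its dyadic diameter sum is, on a space
whose balls have at most quadratic measure. -/
theorem gagliardoEnergy_lt_top_of_diameterSum_lt_top {X Y : Type*} [MetricSpace X]
    [MeasurableSpace X] [OpensMeasurableSpace X] [MetricSpace Y] {μ : Measure X}
    [IsFiniteMeasure μ] {Ω : Set X} (hΩ : ∀ᵐ x ∂μ, x ∈ Ω) {C : ℝ≥0∞} (hC : C ≠ ⊤)
    (hμ : ∀ x r, μ (closedBall x r) ≤ C * ENNReal.ofReal r ^ 2)
    {ι : ℕ → Type} [∀ k, Fintype (ι k)] {Q : ∀ k, ι k → Set X} {p : ∀ k, ι k → X}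
    (hQ : IsDyadicCovering Ω Q p)
    (hconn : ∀ x ∈ Ω, ∀ y ∈ Ω, ∃ K ⊆ Ω ∩ closedBall x (dist x y),
      IsPreconnected K ∧ x ∈ K ∧ y ∈ K)
    {q : ℝ} (hq : 0 < q) {φ : X → Y} (hφ : Continuous φ) (hb : ediam (φ '' Ω) ≠ ⊤)
    (hsum : diameterSum Q q φ < ⊤) : gagliardoEnergy μ q φ < ⊤ := by
  classical
  obtain ⟨D, hD, hp⟩ := hQ.exists_subset_closedBall
  obtain ⟨M, hM⟩ := hQ.exists_ncard_le 1
  simp only [one_mul] at hM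
  set c : ∀ k, ι k → ℝ≥0∞ := fun k j =>
    (M : ℝ≥0∞) ^ q * 2 ^ (((k + 1 : ℕ) : ℝ) * (q + 1)) * ediam (φ '' Q k j) ^ q with hc
  -- A square that meets the ball of radius 2⁻ᵏ about `x` has its centre within (D + 1)·2⁻ᵏ of `x`.
  -- Replacing squares by these balls avoids any measurability question about them.
  set B : ∀ k, ι k → Set X := fun k j => closedBall (p k j) ((D + 1) * 2⁻¹ ^ k) with hB
  set K₀ : ℝ≥0∞ := ediam (φ '' Ω) ^ q * 2 ^ (((1 : ℕ) : ℝ) * (q + 1)) with hK₀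
  have hK₀t : K₀ ≠ ⊤ := ENNReal.mul_ne_top (ENNReal.rpow_ne_top_of_nonneg hq.le hb)
    (ENNReal.rpow_ne_top_of_nonneg (by positivity) (by norm_num))
  have hpt : ∀ x ∈ Ω, ∀ y ∈ Ω,
      ENNReal.ofReal (dist (φ x) (φ y) ^ q / dist x y ^ (q + 1)) ≤
        K₀ + ∑' k : {k : ℕ // 1 ≤ k}, ∑ j, (B k.1 j).indicator (fun _ => c k.1 j) x *
          (closedBall x (2⁻¹ ^ k.1)).indicator (fun _ => (1 : ℝ≥0∞)) y := by
    intro x hx y hy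
    -- On the diagonal the integrand is 0 / 0 = 0.
    rcases eq_or_ne x y with rfl | hxy
    · simp [Real.zero_rpow hq.ne']
    rcases le_or_gt (dist x y) 2⁻¹ with hd | hd
    · obtain ⟨k, hk1, hk2, hk3⟩ := exists_two_inv_pow_lt_le (dist_pos.2 hxy) hd
      refine le_trans ?_ (le_add_of_nonneg_left zero_le)
      refine le_trans ?_ (ENNReal.le_tsum (⟨k, hk1⟩ : {k : ℕ // 1 ≤ k}))
      have hyB : y ∈ closedBall x (2⁻¹ ^ k) := by rwa [mem_closedBall, dist_comm]
      simp only [indicator_of_mem hyB, mul_one]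
      refine (ofReal_dist_rpow_div_le hq φ hk2.le).trans ?_
      set J : Finset (ι k) :=
        Finset.univ.filter fun j => (Q k j ∩ closedBall x (2⁻¹ ^ k)).Nonempty with hJ
      have hJM : J.card ≤ M := by
        have := hM k x
        rwa [Set.ncard_eq_toFinset_card', Set.toFinset_ofPred] at this
      obtain ⟨K, hKs, hKc, hxK, hyK⟩ := hconn x hx y hy
      have hKcov : K ⊆ ⋃ j ∈ J, Q k j := by
        intro z hz
        obtain ⟨j, hj⟩ := hQ.exists_mem k z (hKs hz).1
        refine mem_biUnion (x := j) ?_ hj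
        simp only [hJ, Finset.coe_filter, Finset.mem_univ, true_and, mem_ofPred_eq]
        exact ⟨z, hj, closedBall_subset_closedBall hk3 (hKs hz).2⟩
      have hle := edist_le_sum_ediam_of_isPreconnected hKc hKcov hφ hxK hyK
      calc edist (φ x) (φ y) ^ q * (2 : ℝ≥0∞) ^ (((k + 1 : ℕ) : ℝ) * (q + 1))
          ≤ ((M : ℝ≥0∞) ^ q * ∑ j ∈ J, ediam (φ '' Q k j) ^ q) *
              (2 : ℝ≥0∞) ^ (((k + 1 : ℕ) : ℝ) * (q + 1)) := by
            gcongr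
            refine (ENNReal.rpow_le_rpow hle hq.le).trans
              ((ENNReal.sum_rpow_le_card_rpow_mul_sum _ _ hq).trans ?_)
            gcongr
        _ = ∑ j ∈ J, c k j := by
            rw [mul_right_comm, Finset.mul_sum]
        _ = ∑ j ∈ J, (B k j).indicator (fun _ => c k j) x := by
            refine Finset.sum_congr rfl fun j hj => ?_
            rw [indicator_of_mem]
            simp only [hJ, Finset.mem_filter, Finset.mem_univ, true_and] at hj
            obtain ⟨z, hz, hzx⟩ := hj
            have h1 := mem_closedBall.1 (hp k j hz)
            have h2 := mem_closedBall'.1 hzx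
            rw [hB, mem_closedBall]
            linarith [dist_triangle x z (p k j)]
        _ ≤ ∑ j, (B k j).indicator (fun _ => c k j) x :=
            Finset.sum_le_sum_of_subset (Finset.subset_univ _)
    -- Pairs at distance more than 1/2 are handled by the boundedness of φ(Ω) alone.
    · refine le_trans ?_ (le_add_of_nonneg_right zero_le)
      refine (ofReal_dist_rpow_div_le (k := 1) hq φ (by simpa using hd.le)).trans ?_
      rw [hK₀]
      gcongr
      exact edist_le_ediam_of_mem (mem_image_of_mem φ hx) (mem_image_of_mem φ hy)
  have hinner : ∀ x ∈ Ω,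
      ∫⁻ y, ENNReal.ofReal (dist (φ x) (φ y) ^ q / dist x y ^ (q + 1)) ∂μ ≤
        K₀ * μ univ + ∑' k : {k : ℕ // 1 ≤ k}, ∑ j, (B k.1 j).indicator (fun _ => c k.1 j) x *
          (C * ENNReal.ofReal (2⁻¹ ^ k.1) ^ 2) := by
    intro x hx
    refine (lintegral_mono_ae (hΩ.mono fun y hy => hpt x hx y hy)).trans ?_
    have hmeas : ∀ k : {k : ℕ // 1 ≤ k}, ∀ j, Measurable fun y =>
        (B k.1 j).indicator (fun _ => c k.1 j) x *
          (closedBall x (2⁻¹ ^ k.1)).indicator (fun _ => (1 : ℝ≥0∞)) y := fun k j =>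
      (measurable_const.indicator isClosed_closedBall.measurableSet).const_mul _
    rw [lintegral_add_left measurable_const, lintegral_const, lintegral_tsum fun k =>
      (Finset.measurable_fun_sum _ fun j _ => hmeas k j).aemeasurable]
    gcongr with k
    rw [lintegral_finsetSum _ fun j _ => hmeas k j]
    gcongr with j
    rw [lintegral_const_mul _ (measurable_const.indicator isClosed_closedBall.measurableSet),
      lintegral_indicator_const isClosed_closedBall.measurableSet, one_mul]
    gcongr
    exact hμ _ _
  have houter : gagliardoEnergy μ q φ ≤ K₀ * μ univ * μ univ +
      ∑' k : {k : ℕ // 1 ≤ k}, ∑ j, c k.1 j * (C * ENNReal.ofReal ((D + 1) * 2⁻¹ ^ k.1) ^ 2) *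
          (C * ENNReal.ofReal (2⁻¹ ^ k.1) ^ 2) := by
    refine (lintegral_mono_ae (hΩ.mono fun x hx => hinner x hx)).trans ?_
    have hmeas : ∀ k : {k : ℕ // 1 ≤ k}, ∀ j, Measurable fun x =>
        (B k.1 j).indicator (fun _ => c k.1 j) x * (C * ENNReal.ofReal (2⁻¹ ^ k.1) ^ 2) :=
      fun k j => (measurable_const.indicator isClosed_closedBall.measurableSet).mul_const _
    rw [lintegral_add_left measurable_const, lintegral_const, lintegral_tsum fun k =>
      (Finset.measurable_fun_sum _ fun j _ => hmeas k j).aemeasurable]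
    gcongr with k
    rw [lintegral_finsetSum _ fun j _ => hmeas k j]
    gcongr with j
    rw [lintegral_mul_const _ (measurable_const.indicator isClosed_closedBall.measurableSet),
      lintegral_indicator_const isClosed_closedBall.measurableSet]
    gcongr
    exact hμ _ _
  refine houter.trans_lt (ENNReal.add_lt_top.2 ⟨?_, ?_⟩)
  · exact (ENNReal.mul_ne_top (ENNReal.mul_ne_top hK₀t (measure_ne_top μ _))
      (measure_ne_top μ _)).lt_top
  · have heq : ∀ k : {k : ℕ // 1 ≤ k},
        ∑ j, c k.1 j * (C * ENNReal.ofReal ((D + 1) * 2⁻¹ ^ k.1) ^ 2) *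
          (C * ENNReal.ofReal (2⁻¹ ^ k.1) ^ 2) =
        ((M : ℝ≥0∞) ^ q * 2 ^ (q + 1) * (C * C) * ENNReal.ofReal (D + 1) ^ 2) *
          (2 ^ ((k.1 : ℝ) * (q - 3)) * ∑ j, ediam (φ '' Q k.1 j) ^ q) := by
      intro k
      rw [Finset.mul_sum, Finset.mul_sum]
      refine Finset.sum_congr rfl fun j _ => ?_
      -- The kernel contributes (k + 1)(q + 1), the two balls contribute -4k.
      have h2 : (2 : ℝ≥0∞) ^ (((k.1 + 1 : ℕ) : ℝ) * (q + 1)) * (2 ^ (-(k.1 : ℝ))) ^ 4 =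
          2 ^ (q + 1) * 2 ^ ((k.1 : ℝ) * (q - 3)) := by
        rw [← ENNReal.rpow_mul_natCast, ← ENNReal.two_rpow_add, ← ENNReal.two_rpow_add]
        congr 1
        push_cast
        ring
      rw [ENNReal.ofReal_mul (by positivity), ENNReal.ofReal_two_inv_pow]
      simp only [hc]
      calc _ = (2 : ℝ≥0∞) ^ (((k.1 + 1 : ℕ) : ℝ) * (q + 1)) * (2 ^ (-(k.1 : ℝ))) ^ 4 *
            ((M : ℝ≥0∞) ^ q * (C * C) * ENNReal.ofReal (D + 1) ^ 2 *
              ediam (φ '' Q k.1 j) ^ q) := by ring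
        _ = _ := by rw [h2]; ring
    rw [tsum_congr heq, ENNReal.tsum_mul_left]
    refine ENNReal.mul_lt_top (lt_top_iff_ne_top.2 ?_) hsum
    refine ENNReal.mul_ne_top (ENNReal.mul_ne_top (ENNReal.mul_ne_top ?_ ?_) ?_) ?_
    · exact ENNReal.rpow_ne_top_of_nonneg hq.le (by simp)
    · exact ENNReal.rpow_ne_top_of_nonneg (by positivity) (by norm_num)
    · exact ENNReal.mul_ne_top hC hC
    · simp

/-! ### Telescoping through shrinking balls -/

/-- The double integral of `|φ x - φ y| ^ q` over `B × B`. -/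
noncomputable def oscillationEnergy {X Y : Type*} [MeasurableSpace X] [MetricSpace Y] (μ : Measure X)
    (q : ℝ) (φ : X → Y) (B : Set X) : ℝ≥0∞ :=
  ∫⁻ x in B, ∫⁻ y in B, edist (φ x) (φ y) ^ q ∂μ ∂μ

theorem oscillation_mono {X Y : Type*} [MeasurableSpace X] [MetricSpace Y] {μ : Measure X}
    {q : ℝ} {φ : X → Y} {B B' : Set X} (h : B' ⊆ B) :
    oscillationEnergy μ q φ B' ≤ oscillationEnergy μ q φ B :=
  (lintegral_mono_set h).trans (lintegral_mono fun _ => lintegral_mono_set h)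

/-- Average over `y` in `B'` the triangle inequality through φ(y); convexity of the power gives
2^(q-1). One inverse measure comes from this average, the other from the choice of `c` and `c'`. -/
theorem edist_rpow_le_oscillation {X Y : Type*} [MetricSpace X] [MeasurableSpace X]
    [OpensMeasurableSpace X] [MetricSpace Y] {μ : Measure X} {q : ℝ} {φ : X → Y} (hq : 1 ≤ q) (hφ : Continuous φ) {B B' : Set X} (h : B' ⊆ B)
    (h0 : μ B' ≠ 0) (htop : μ B ≠ ⊤) {c c' : X}
    (hc : ∫⁻ y in B, edist (φ c) (φ y) ^ q ∂μ ≤ (μ B)⁻¹ * oscillationEnergy μ q φ B)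
    (hc' : ∫⁻ y in B', edist (φ c') (φ y) ^ q ∂μ ≤ (μ B')⁻¹ * oscillationEnergy μ q φ B') :
    edist (φ c) (φ c') ^ q ≤ 2 ^ (q - 1) * 2 * (μ B')⁻¹ ^ 2 * oscillationEnergy μ q φ B := by
  have htop' : μ B' ≠ ⊤ := ne_top_of_le_ne_top htop (measure_mono h)
  have hm : ∀ z, Measurable fun y => edist (φ z) (φ y) ^ q := fun z =>
    ((continuous_const.edist hφ).measurable).pow_const q
  have h1 : μ B' * edist (φ c) (φ c') ^ q ≤
      2 ^ (q - 1) * 2 * (μ B')⁻¹ * oscillationEnergy μ q φ B := by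
    calc μ B' * edist (φ c) (φ c') ^ q = ∫⁻ _ in B', edist (φ c) (φ c') ^ q ∂μ := by
          rw [setLIntegral_const, mul_comm]
      _ ≤ ∫⁻ y in B', 2 ^ (q - 1) * (edist (φ c) (φ y) ^ q + edist (φ c') (φ y) ^ q) ∂μ := by
          refine lintegral_mono fun y => ?_
          refine (ENNReal.rpow_le_rpow (edist_triangle_right _ _ (φ y)) (by linarith)).trans ?_
          exact ENNReal.rpow_add_le_mul_rpow_add_rpow _ _ hq
      _ = 2 ^ (q - 1) * (∫⁻ y in B', edist (φ c) (φ y) ^ q ∂μ +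
            ∫⁻ y in B', edist (φ c') (φ y) ^ q ∂μ) := by
          rw [lintegral_const_mul' _ _ (ENNReal.rpow_ne_top_of_nonneg (by linarith) (by norm_num)),
            lintegral_add_left (hm c)]
      _ ≤ 2 ^ (q - 1) * ((μ B')⁻¹ * oscillationEnergy μ q φ B + (μ B')⁻¹ * oscillationEnergy μ q φ B) := by
          gcongr
          · refine (lintegral_mono_set h).trans (hc.trans ?_)
            gcongr
          · refine hc'.trans ?_
            gcongr
            exact oscillation_mono h
      _ = _ := by ring
  calc edist (φ c) (φ c') ^ q = (μ B')⁻¹ * (μ B' * edist (φ c) (φ c') ^ q) := by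
        rw [← mul_assoc, ENNReal.inv_mul_cancel h0 htop', one_mul]
    _ ≤ (μ B')⁻¹ * (2 ^ (q - 1) * 2 * (μ B')⁻¹ * oscillationEnergy μ q φ B) := by gcongr
    _ = _ := by ring

section

variable {X Y : Type*} [MetricSpace X] [MeasurableSpace X] [BorelSpace X]
  [SecondCountableTopology X] [MetricSpace Y] {μ : Measure X} [SFinite μ] {q : ℝ} {φ : X → Y}

theorem measurable_edist_rpow (hφ : Continuous φ) :
    Measurable fun z : X × X => edist (φ z.1) (φ z.2) ^ q :=
  (((hφ.comp continuous_fst).edist (hφ.comp continuous_snd)).measurable).pow_const q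

/-- A point of `B` from which the `q`-mean distance in `B` is at most the average one. -/
theorem exists_lintegral_edist_rpow_le (hφ : Continuous φ) {B : Set X} (h0 : μ B ≠ 0)
    (htop : μ B ≠ ⊤) :
    ∃ c ∈ B, ∫⁻ y in B, edist (φ c) (φ y) ^ q ∂μ ≤ (μ B)⁻¹ * oscillationEnergy μ q φ B := by
  obtain ⟨c, hc, h⟩ := exists_le_setLAverage h0 htop
    (f := fun x => ∫⁻ y in B, edist (φ x) (φ y) ^ q ∂μ)
    (measurable_edist_rpow hφ).lintegral_prod_right'.aemeasurable
  refine ⟨c, hc, h.trans ?_⟩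
  rw [setLAverage_eq, div_eq_mul_inv, mul_comm]
  rfl

open Metric in
/-- Telescoping along a decreasing sequence of sets that shrinks to the point `x`. -/
theorem edist_le_tsum_oscillation (hq : 1 ≤ q) (hφ : Continuous φ) {B : ℕ → Set X} {x c₀ : X}
    {ρ : ℕ → ℝ} (hρ : Filter.Tendsto ρ Filter.atTop (nhds 0)) (hB : Antitone B)
    (hBx : ∀ i, B (i + 1) ⊆ closedBall x (ρ i)) (h0 : ∀ i, μ (B i) ≠ 0) (htop : ∀ i, μ (B i) ≠ ⊤)
    (hc₀ : ∫⁻ y in B 0, edist (φ c₀) (φ y) ^ q ∂μ ≤ (μ (B 0))⁻¹ * oscillationEnergy μ q φ (B 0)) :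
    edist (φ c₀) (φ x) ≤
      ∑' i, (2 ^ (q - 1) * 2 * (μ (B (i + 1)))⁻¹ ^ 2 * oscillationEnergy μ q φ (B i)) ^ q⁻¹ := by
  choose b hbB hb using fun i => exists_lintegral_edist_rpow_le (q := q) (μ := μ) hφ (h0 i) (htop i)
  -- The first point is prescribed rather than chosen, so that chains ending at different points can
  -- share it.
  set c : ℕ → X := fun i => Nat.casesOn i c₀ fun n => b (n + 1) with hc
  have hgood : ∀ i, ∫⁻ y in B i, edist (φ (c i)) (φ y) ^ q ∂μ ≤
      (μ (B i))⁻¹ * oscillationEnergy μ q φ (B i) := by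
    rintro (_ | i)
    · exact hc₀
    · exact hb (i + 1)
  have hlim : Filter.Tendsto c Filter.atTop (nhds x) := by
    rw [← Filter.tendsto_add_atTop_iff_nat 1, tendsto_iff_dist_tendsto_zero]
    exact squeeze_zero (fun _ => dist_nonneg) (fun i => hBx i (hbB (i + 1))) hρ
  refine edist_le_tsum_of_edist_le_of_tendsto₀ (f := fun i => φ (c i)) _ (fun i => ?_)
    ((hφ.tendsto x).comp hlim)
  rw [ENNReal.le_rpow_inv_iff (by linarith)]
  exact edist_rpow_le_oscillation hq hφ (hB i.le_succ) (h0 _) (htop _) (hgood i) (hgood (i + 1))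

end

theorem ENNReal.tsum_two_rpow_neg_ne_top {s : ℝ} (hs : 0 < s) :
    ∑' i : ℕ, (2 : ℝ≥0∞) ^ (-(i * s)) ≠ ⊤ := by
  have h : ∀ i : ℕ, (2 : ℝ≥0∞) ^ (-(i * s)) = (2 ^ (-s)) ^ i := fun i => by
    rw [← ENNReal.rpow_mul_natCast]
    congr 1
    ring
  rw [tsum_congr h, ENNReal.tsum_geometric]
  refine ENNReal.inv_ne_top.2 (tsub_pos_of_lt ?_).ne'
  exact ENNReal.rpow_lt_one_of_one_lt_of_neg (by norm_num) (by linarith)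

/-- Each term satisfies a_i ≤ 2^(-iε) S, where S is the weighted sum, so the roots are dominated by
a geometric series times S^(1/q). This stands in for Hölder's inequality; the constant is finite
when ε > 0. -/
theorem ENNReal.tsum_rpow_inv_rpow_le (a : ℕ → ℝ≥0∞) {q ε : ℝ} (hq : 0 < q) :
    (∑' i, a i ^ q⁻¹) ^ q ≤
      (∑' i : ℕ, (2 : ℝ≥0∞) ^ (-(i * (ε / q)))) ^ q * ∑' i : ℕ, 2 ^ (i * ε) * a i := by
  set S := ∑' i : ℕ, 2 ^ (i * ε) * a i with hS
  have h : ∀ i : ℕ, a i ^ q⁻¹ ≤ 2 ^ (-(i * (ε / q))) * S ^ q⁻¹ := by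
    intro i
    have h1 : a i ≤ 2 ^ (-(i * ε)) * S := by
      calc a i = 2 ^ (-(i * ε)) * (2 ^ (i * ε) * a i) := by
            rw [← mul_assoc, ← ENNReal.two_rpow_add, neg_add_cancel, ENNReal.rpow_zero, one_mul]
        _ ≤ _ := by
            gcongr
            exact ENNReal.le_tsum (f := fun i : ℕ => 2 ^ (i * ε) * a i) i
    calc a i ^ q⁻¹ ≤ (2 ^ (-(i * ε)) * S) ^ q⁻¹ := ENNReal.rpow_le_rpow h1 (by positivity)
      _ = _ := by
          rw [ENNReal.mul_rpow_of_nonneg _ _ (by positivity), ← ENNReal.rpow_mul]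
          congr 2
          ring
  calc (∑' i, a i ^ q⁻¹) ^ q ≤ ((∑' i : ℕ, (2 : ℝ≥0∞) ^ (-(i * (ε / q)))) * S ^ q⁻¹) ^ q := by
        rw [← ENNReal.tsum_mul_right]
        exact ENNReal.rpow_le_rpow (ENNReal.tsum_le_tsum h) hq.le
    _ = _ := by
        rw [ENNReal.mul_rpow_of_nonneg _ _ hq.le, ENNReal.rpow_inv_rpow hq.ne']

/-! ### Spheres, annuli and integration over the radius -/

/-- The integral of `|φ u - φ v| ^ q` over the points `v` with `|u - v| ≤ R`. -/
noncomputable def ballEnergy {X Y : Type*} [MetricSpace X] [MeasurableSpace X] [MetricSpace Y]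
    (μ : Measure X) (q : ℝ) (φ : X → Y) (R : ℝ) (u : X) : ℝ≥0∞ :=
  ∫⁻ v in Metric.closedBall u R, edist (φ u) (φ v) ^ q ∂μ

section

open Metric

theorem ballEnergy_eq_lintegral_indicator {X Y : Type*} [MetricSpace X] [MeasurableSpace X]
    [OpensMeasurableSpace X] [MetricSpace Y] {μ : Measure X} {q : ℝ} {φ : X → Y} (R : ℝ) (u : X) :
    ballEnergy μ q φ R u = ∫⁻ v, {z : X × X | dist z.2 z.1 ≤ R}.indicator
      (fun z => edist (φ z.1) (φ z.2) ^ q) (u, v) ∂μ := by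
  rw [ballEnergy, ← lintegral_indicator isClosed_closedBall.measurableSet]
  rfl

theorem oscillationEnergy_le_lintegral_ballEnergy {X Y : Type*} [MetricSpace X] [MeasurableSpace X]
    [MetricSpace Y] {μ : Measure X} {q : ℝ} {φ : X → Y} {B S : Set X} (hB : MeasurableSet B)
    (hS : B ⊆ S) {R : ℝ} (hR : ∀ u ∈ B, B ⊆ closedBall u R) :
    oscillationEnergy μ q φ B ≤ ∫⁻ u in S, ballEnergy μ q φ R u ∂μ :=
  (setLIntegral_mono' hB fun u hu => lintegral_mono_set (hR u hu)).trans (lintegral_mono_set hS)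

/-- Moves the dependence on `t` from the domain into an indicator on ℝ × X, where joint
measurability and Tonelli apply. -/
theorem setLIntegral_inter_annulus {X : Type*} [MetricSpace X] [MeasurableSpace X]
    [OpensMeasurableSpace X] {μ : Measure X} (A : Set X) (R : ℝ) (x₀ : X) (H : X → ℝ≥0∞) (t : ℝ) :
    ∫⁻ u in A ∩ {u | |dist u x₀ - t| ≤ R}, H u ∂μ =
      ∫⁻ u in A, {z : ℝ × X | |dist z.2 x₀ - z.1| ≤ R}.indicator (fun z => H z.2) (t, u) ∂μ := by
  have hS : MeasurableSet {u : X | |dist u x₀ - t| ≤ R} :=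
    (isClosed_le (((continuous_id.dist continuous_const).sub continuous_const).abs)
      continuous_const).measurableSet
  rw [inter_comm, ← Measure.restrict_restrict hS, ← lintegral_indicator hS]
  rfl

variable {X Y : Type*} [MetricSpace X] [MeasurableSpace X] [BorelSpace X]
  [SecondCountableTopology X] [MetricSpace Y] {μ : Measure X} [SFinite μ] {q : ℝ} {φ : X → Y}

theorem measurable_ballEnergy (hφ : Continuous φ) (R : ℝ) : Measurable (ballEnergy μ q φ R) := by
  rw [funext (ballEnergy_eq_lintegral_indicator R)]
  exact ((measurable_edist_rpow hφ).indicator (isClosed_le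
    (continuous_snd.dist continuous_fst) continuous_const).measurableSet).lintegral_prod_right'

/-- All points of the sphere are joined to one common point `c₀`, so the diameter is at most twice a
bound for the chains. The balls of a chain depend on its endpoint; enlarging their domain of
integration to an annulus about `x₀` removes this dependence and leaves a bound that can be
integrated in `t`. -/
theorem ediam_image_sphere_rpow_le (hq : 1 ≤ q) (hφ : Continuous φ) {c : ℝ≥0∞} (hc : c ≠ 0)
    (hlow : ∀ x (j : ℕ), c * ENNReal.ofReal (2⁻¹ ^ j) ^ 2 ≤ μ (closedBall x (2⁻¹ ^ j)))
    (hfin : ∀ x r, μ (closedBall x r) ≠ ⊤) (k : ℕ) {t : ℝ}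
    (ht : t ∈ Icc (2⁻¹ ^ k : ℝ) (2 * 2⁻¹ ^ k)) (x₀ : X) (ε : ℝ) :
    ediam (φ '' sphere x₀ t) ^ q ≤ 2 ^ q * (∑' i : ℕ, (2 : ℝ≥0∞) ^ (-(i * (ε / q)))) ^ q *
      ∑' i : ℕ, 2 ^ (i * ε) * (2 ^ (q - 1) * 2 * (c * ENNReal.ofReal (2⁻¹ ^ (k + i)) ^ 2)⁻¹ ^ 2 *
        ∫⁻ u in closedBall x₀ (8 * 2⁻¹ ^ k) ∩ {u | |dist u x₀ - t| ≤ 8 * 2⁻¹ ^ (k + i)},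
          ballEnergy μ q φ (8 * 2⁻¹ ^ (k + i)) u ∂μ) := by
  have hq0 : 0 < q := by linarith
  have hr : ∀ i : ℕ, (0 : ℝ) < 2⁻¹ ^ i := fun i => by positivity
  have hrk : ∀ i : ℕ, (2⁻¹ : ℝ) ^ (k + i) ≤ 2⁻¹ ^ k := fun i =>
    pow_le_pow_of_le_one (by norm_num) (by norm_num) (by omega)
  have hpos : ∀ x (j : ℕ), μ (closedBall x (2⁻¹ ^ j)) ≠ 0 := fun x j h => by
    have := hlow x j
    rw [h, nonpos_iff_eq_zero, mul_eq_zero] at this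
    rcases this with h | h
    · exact hc h
    · have := hr j
      simp at h
  have hsub₀ : closedBall x₀ (2⁻¹ ^ k) ⊆ closedBall x₀ (4 * 2⁻¹ ^ k) :=
    closedBall_subset_closedBall (by linarith [hr k])
  have hpos₀ : μ (closedBall x₀ (4 * 2⁻¹ ^ k)) ≠ 0 := fun h =>
    hpos x₀ k (measure_mono_null hsub₀ h)
  obtain ⟨c₀, -, hc₀⟩ := exists_lintegral_edist_rpow_le (q := q) (μ := μ) hφ hpos₀ (hfin _ _)
  set G : ℕ → ℝ≥0∞ := fun i =>
    ∫⁻ u in closedBall x₀ (8 * 2⁻¹ ^ k) ∩ {u | |dist u x₀ - t| ≤ 8 * 2⁻¹ ^ (k + i)},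
      ballEnergy μ q φ (8 * 2⁻¹ ^ (k + i)) u ∂μ with hG
  set a : ℕ → ℝ≥0∞ := fun i =>
    2 ^ (q - 1) * 2 * (c * ENNReal.ofReal (2⁻¹ ^ (k + i)) ^ 2)⁻¹ ^ 2 * G i with ha
  have hx : ∀ x ∈ sphere x₀ t, edist (φ c₀) (φ x) ≤ ∑' i, a i ^ q⁻¹ := by
    intro x hx
    rw [mem_sphere] at hx
    -- The initial ball is centred at `x₀` and hence the same for all `x`. Radius 4·2⁻ᵏ suffices to
    -- contain the next ball, as `x` is within 2·2⁻ᵏ of `x₀`.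
    set B : ℕ → Set X := fun i => Nat.casesOn i (closedBall x₀ (4 * 2⁻¹ ^ k))
      fun n => closedBall x (2⁻¹ ^ (k + n)) with hB
    have hBm : ∀ i, MeasurableSet (B i) := by
      rintro (_ | i) <;> exact isClosed_closedBall.measurableSet
    have hBanti : Antitone B := by
      refine antitone_nat_of_succ_le ?_
      rintro (_ | i)
      · refine closedBall_subset_closedBall' ?_
        simp only [add_zero]
        linarith [ht.2, hr k]
      · exact closedBall_subset_closedBall
          (pow_le_pow_of_le_one (by norm_num) (by norm_num) (by omega))
    refine (edist_le_tsum_oscillation hq hφ (B := B) (x := x) (ρ := fun i => 2⁻¹ ^ (k + i))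
      ?_ hBanti (fun i => subset_rfl) ?_ ?_ hc₀).trans (ENNReal.tsum_le_tsum fun i => ?_)
    · have := (tendsto_pow_atTop_nhds_zero_of_lt_one (r := (2⁻¹ : ℝ)) (by norm_num)
        (by norm_num)).comp (Filter.tendsto_add_atTop_nat k)
      refine this.congr fun i => ?_
      simp [add_comm]
    · rintro (_ | i)
      exacts [hpos₀, hpos _ _]
    · rintro (_ | i)
      exacts [hfin _ _, hfin _ _]
    · refine ENNReal.rpow_le_rpow ?_ (by positivity)
      refine mul_le_mul' (mul_le_mul_right ?_ _) ?_
      · gcongr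
        exact hlow x (k + i)
      -- The constant 8 is the diameter bound for the initial ball; the later ones, of radius
      -- 2·2^(-(k+i)) in terms of their index i, leave room to spare.
      · refine oscillationEnergy_le_lintegral_ballEnergy (hBm i) ?_ ?_
        · rcases i with _ | i
          · intro u hu
            have hu' : dist u x₀ ≤ 4 * 2⁻¹ ^ k := hu
            refine ⟨?_, ?_⟩
            · rw [mem_closedBall]
              linarith [hr k]
            · have := hr k
              have h0 : 0 ≤ dist u x₀ := dist_nonneg
              simp only [mem_ofPred_eq, add_zero, abs_le]
              constructor <;> linarith [ht.1, ht.2]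
          · intro u hu
            have hu' : dist u x ≤ 2⁻¹ ^ (k + i) := hu
            refine ⟨?_, ?_⟩
            · rw [mem_closedBall]
              linarith [hr k, hrk i, dist_triangle u x x₀, ht.2]
            · have h1 := abs_dist_sub_le u x x₀
              rw [hx] at h1
              simp only [mem_ofPred_eq, ← add_assoc, pow_succ _ (k + i)]
              linarith [hr (k + i)]
        · rcases i with _ | i
          · intro u hu v hv
            have hu' : dist u x₀ ≤ 4 * 2⁻¹ ^ k := hu
            have hv' : dist v x₀ ≤ 4 * 2⁻¹ ^ k := hv
            rw [mem_closedBall, add_zero]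
            linarith [dist_triangle_right v u x₀]
          · intro u hu v hv
            have hu' : dist u x ≤ 2⁻¹ ^ (k + i) := hu
            have hv' : dist v x ≤ 2⁻¹ ^ (k + i) := hv
            rw [mem_closedBall, ← add_assoc, pow_succ _ (k + i)]
            linarith [dist_triangle_right v u x, hr (k + i)]
  have hdiam : ediam (φ '' sphere x₀ t) ≤ 2 * ∑' i, a i ^ q⁻¹ := by
    refine ediam_le ?_
    rintro _ ⟨x, hxs, rfl⟩ _ ⟨y, hys, rfl⟩
    rw [two_mul]
    exact (edist_triangle_left _ _ (φ c₀)).trans (add_le_add (hx x hxs) (hx y hys))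
  calc ediam (φ '' sphere x₀ t) ^ q ≤ (2 * ∑' i, a i ^ q⁻¹) ^ q :=
        ENNReal.rpow_le_rpow hdiam hq0.le
    _ = 2 ^ q * (∑' i, a i ^ q⁻¹) ^ q := ENNReal.mul_rpow_of_nonneg _ _ hq0.le
    _ ≤ 2 ^ q * ((∑' i : ℕ, (2 : ℝ≥0∞) ^ (-(i * (ε / q)))) ^ q *
          ∑' i : ℕ, 2 ^ (i * ε) * a i) := by
        gcongr
        exact ENNReal.tsum_rpow_inv_rpow_le a hq0
    _ = _ := by rw [mul_assoc]

theorem measurable_annulus_indicator (R : ℝ) (x₀ : X) {H : X → ℝ≥0∞} (hH : Measurable H) :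
    Measurable ({z : ℝ × X | |dist z.2 x₀ - z.1| ≤ R}.indicator fun z => H z.2) :=
  (hH.comp measurable_snd).indicator (isClosed_le
    (((continuous_snd.dist continuous_const).sub continuous_fst).abs)
      continuous_const).measurableSet

theorem measurable_setLIntegral_annulus (A : Set X) (R : ℝ) (x₀ : X) {H : X → ℝ≥0∞}
    (hH : Measurable H) :
    Measurable fun t : ℝ => ∫⁻ u in A ∩ {u | |dist u x₀ - t| ≤ R}, H u ∂μ := by
  simp only [setLIntegral_inter_annulus]
  exact (measurable_annulus_indicator R x₀ hH).lintegral_prod_right'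

/-- Integrating over the radius: a point lies in an annulus of half-width `R` for a set of radii
of measure at most `2 R`. -/
theorem lintegral_setLIntegral_annulus_le (A : Set X) (R : ℝ) (x₀ : X) {H : X → ℝ≥0∞}
    (hH : Measurable H) :
    ∫⁻ t : ℝ, ∫⁻ u in A ∩ {u | |dist u x₀ - t| ≤ R}, H u ∂μ ≤
      ENNReal.ofReal (2 * R) * ∫⁻ u in A, H u ∂μ := by
  simp only [setLIntegral_inter_annulus]
  rw [lintegral_lintegral_swap (f := fun (t : ℝ) (u : X) =>
      {z : ℝ × X | |dist z.2 x₀ - z.1| ≤ R}.indicator (fun z => H z.2) (t, u)) (measurable_annulus_indicator R x₀ hH).aemeasurable,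
    ← lintegral_const_mul _ hH]
  refine lintegral_mono fun u => ?_
  have : ∀ t : ℝ, {z : ℝ × X | |dist z.2 x₀ - z.1| ≤ R}.indicator (fun z => H z.2) (t, u) =
      (Icc (dist u x₀ - R) (dist u x₀ + R)).indicator (fun _ => H u) t := by
    intro t
    refine indicator_eq_indicator ?_ rfl
    simp only [mem_ofPred_eq, mem_Icc, abs_le]
    constructor <;> rintro ⟨h1, h2⟩ <;> constructor <;> linarith
  simp only [this]
  rw [lintegral_indicator_const measurableSet_Icc, Real.volume_Icc, mul_comm]
  gcongr
  linarith

/-- A bound for the diameter of the image of a small ball, when that diameter is controlled by the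
images of the metric spheres with the same centre. -/
theorem ediam_image_closedBall_rpow_le (hq : 1 ≤ q) (hφ : Continuous φ) {c : ℝ≥0∞} (hc : c ≠ 0)
    (hlow : ∀ x (j : ℕ), c * ENNReal.ofReal (2⁻¹ ^ j) ^ 2 ≤ μ (closedBall x (2⁻¹ ^ j)))
    (hfin : ∀ x r, μ (closedBall x r) ≠ ⊤) (k : ℕ) (x₀ : X) (ε : ℝ)
    (hsph : ∀ t ∈ Icc (2⁻¹ ^ k : ℝ) (2 * 2⁻¹ ^ k),
      ediam (φ '' closedBall x₀ (2⁻¹ ^ k)) ≤ ediam (φ '' sphere x₀ t)) :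
    ENNReal.ofReal (2⁻¹ ^ k) * ediam (φ '' closedBall x₀ (2⁻¹ ^ k)) ^ q ≤
      2 ^ q * (∑' i : ℕ, (2 : ℝ≥0∞) ^ (-(i * (ε / q)))) ^ q *
      ∑' i : ℕ, 2 ^ (i * ε) * (2 ^ (q - 1) * 2 * (c * ENNReal.ofReal (2⁻¹ ^ (k + i)) ^ 2)⁻¹ ^ 2 *
        (ENNReal.ofReal (2 * (8 * 2⁻¹ ^ (k + i))) * ∫⁻ u in closedBall x₀ (8 * 2⁻¹ ^ k),
          ballEnergy μ q φ (8 * 2⁻¹ ^ (k + i)) u ∂μ)) := by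
  have hball := fun i : ℕ => measurable_ballEnergy (μ := μ) (q := q) hφ (8 * 2⁻¹ ^ (k + i))
  have hmeas := fun i : ℕ => measurable_setLIntegral_annulus (μ := μ)
    (closedBall x₀ (8 * 2⁻¹ ^ k)) (8 * 2⁻¹ ^ (k + i)) x₀ (hball i)
  calc ENNReal.ofReal (2⁻¹ ^ k) * ediam (φ '' closedBall x₀ (2⁻¹ ^ k)) ^ q
      -- The interval of admissible radii has length 2⁻ᵏ.
      = ∫⁻ _ in Icc (2⁻¹ ^ k : ℝ) (2 * 2⁻¹ ^ k), ediam (φ '' closedBall x₀ (2⁻¹ ^ k)) ^ q := by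
        rw [setLIntegral_const, Real.volume_Icc, mul_comm]
        congr 2
        ring
    _ ≤ ∫⁻ t in Icc (2⁻¹ ^ k : ℝ) (2 * 2⁻¹ ^ k), _ :=
        setLIntegral_mono' measurableSet_Icc fun t ht =>
          (ENNReal.rpow_le_rpow (hsph t ht) (by linarith)).trans
            (ediam_image_sphere_rpow_le hq hφ hc hlow hfin k ht x₀ ε)
    _ ≤ ∫⁻ t : ℝ, _ := setLIntegral_le_lintegral _ _
    _ ≤ _ := by
        rw [lintegral_const_mul _ (Measurable.tsum fun i => ((hmeas i).const_mul _).const_mul _),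
          lintegral_tsum fun i => (((hmeas i).const_mul _).const_mul _).aemeasurable]
        gcongr with i
        rw [lintegral_const_mul _ ((hmeas i).const_mul _), lintegral_const_mul _ (hmeas i)]
        gcongr
        exact lintegral_setLIntegral_annulus_le _ _ _ (hball i)

end

/-! ### Summing ball energies over dyadic scales -/

theorem ENNReal.sum_range_pow_le {a : ℝ≥0∞} (ha : 2 ≤ a) (n : ℕ) :
    ∑ i ∈ Finset.range n, a ^ i ≤ a ^ n := by
  induction n with
  | zero => simp
  | succ n ih =>
    rw [Finset.sum_range_succ, pow_succ]
    calc _ ≤ a ^ n + a ^ n := by gcongr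
      _ = a ^ n * 2 := (mul_two _).symm
      _ ≤ _ := by gcongr

-- Only scales with |u - v| ≤ 8·2⁻ʲ contribute, and the geometric sum of 2^(j(q+1)) over them is
-- comparable to its largest term, that is, to |u - v|^(-(q+1)).
open Metric in
theorem tsum_indicator_closedBall_le {X Y : Type*} [MetricSpace X] [MetricSpace Y] {q : ℝ}
    (hq : 0 < q) (φ : X → Y) (u v : X) :
    ∑' j : ℕ, 2 ^ (j * (q + 1)) *
        (closedBall u (8 * 2⁻¹ ^ j)).indicator (fun v => edist (φ u) (φ v) ^ q) v ≤
      2 ^ (q + 1) * ENNReal.ofReal (8⁻¹ ^ (-(q + 1))) *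
        ENNReal.ofReal (dist (φ u) (φ v) ^ q / dist u v ^ (q + 1)) := by
  classical
  rcases eq_or_ne u v with rfl | huv
  · simp [ENNReal.zero_rpow_of_pos hq]
  have hd : 0 < dist u v := dist_pos.2 huv
  have hex : ∃ n : ℕ, (8 : ℝ) * 2⁻¹ ^ n < dist u v := by
    obtain ⟨n, hn⟩ := exists_pow_lt_of_lt_one (show 0 < dist u v / 8 by positivity)
      (show (2⁻¹ : ℝ) < 1 by norm_num)
    exact ⟨n, by linarith⟩
  set n := Nat.find hex with hn
  have hspec : (8 : ℝ) * 2⁻¹ ^ n < dist u v := Nat.find_spec hex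
  have hmem : ∀ j : ℕ, v ∈ closedBall u (8 * 2⁻¹ ^ j) → j < n := by
    intro j hj
    rw [mem_closedBall'] at hj
    by_contra! h
    have h1 : (2⁻¹ : ℝ) ^ j ≤ 2⁻¹ ^ n := pow_le_pow_of_le_one (by norm_num) (by norm_num) h
    linarith
  have hpow : ∀ j : ℕ, (2 : ℝ≥0∞) ^ (j * (q + 1)) = (2 ^ (q + 1)) ^ j := fun j => by
    rw [← ENNReal.rpow_mul_natCast, mul_comm]
  rw [ofReal_dist_rpow_div hq]
  calc _ ≤ ∑ j ∈ Finset.range n, (2 : ℝ≥0∞) ^ (j * (q + 1)) * edist (φ u) (φ v) ^ q := by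
        rw [tsum_eq_sum (s := Finset.range n)]
        · gcongr with j
          exact indicator_le_self _ (fun v => edist (φ u) (φ v) ^ q) v
        · intro j hj
          rw [indicator_of_notMem, mul_zero]
          exact fun h => hj (Finset.mem_range.2 (hmem j h))
    _ = (∑ j ∈ Finset.range n, (2 ^ (q + 1) : ℝ≥0∞) ^ j) * edist (φ u) (φ v) ^ q := by
        rw [Finset.sum_mul]
        simp only [hpow]
    _ ≤ (2 ^ (q + 1) * ENNReal.ofReal (8⁻¹ ^ (-(q + 1))) *
          ENNReal.ofReal (dist u v ^ (-(q + 1)))) * edist (φ u) (φ v) ^ q := by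
        gcongr
        rcases Nat.eq_zero_or_pos n with h0 | hpos
        · simp [h0]
        have h2 : (2 : ℝ≥0∞) ≤ 2 ^ (q + 1) := by
          conv_lhs => rw [← ENNReal.rpow_one 2]
          exact ENNReal.rpow_le_rpow_of_exponent_le (by norm_num) (by linarith)
        refine (ENNReal.sum_range_pow_le h2 n).trans ?_
        -- With n = m + 1, minimality of n gives |u - v| ≤ 8·2⁻ᵐ; this explains the factor 8⁻¹ ^
        -- (-(q + 1)), and the extra power in n = m + 1 the factor 2^(q+1).
        obtain ⟨m, hm⟩ := Nat.exists_eq_add_of_le' hpos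
        rw [hm, pow_succ', ← hpow, mul_assoc, ← ofReal_two_inv_pow_rpow_neg,
          ← ENNReal.ofReal_mul (by positivity), ← Real.mul_rpow (by norm_num) hd.le]
        refine mul_le_mul_right (ENNReal.ofReal_le_ofReal
          (Real.rpow_le_rpow_of_nonpos (by positivity) ?_ (by linarith))) _
        have := Nat.find_min hex (m := m) (by omega)
        linarith
    _ = _ := by ring

open Metric in
theorem tsum_lintegral_ballEnergy_le {X Y : Type*} [MetricSpace X] [MeasurableSpace X]
    [BorelSpace X] [SecondCountableTopology X] [MetricSpace Y] {ν : Measure X} [SFinite ν] {q : ℝ}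
    (hq : 0 < q) {φ : X → Y} (hφ : Continuous φ) :
    ∑' j : ℕ, 2 ^ (j * (q + 1)) * ∫⁻ u, ballEnergy ν q φ (8 * 2⁻¹ ^ j) u ∂ν ≤
      2 ^ (q + 1) * ENNReal.ofReal (8⁻¹ ^ (-(q + 1))) * gagliardoEnergy ν q φ := by
  have hball := fun j : ℕ => measurable_ballEnergy (μ := ν) (q := q) hφ (8 * 2⁻¹ ^ j)
  have hm : ∀ u, ∀ j : ℕ, Measurable
      ((closedBall u (8 * 2⁻¹ ^ j)).indicator fun v => edist (φ u) (φ v) ^ q) := fun u j =>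
    (((continuous_const.edist hφ).measurable).pow_const q).indicator
      isClosed_closedBall.measurableSet
  have hK : (2 : ℝ≥0∞) ^ (q + 1) * ENNReal.ofReal (8⁻¹ ^ (-(q + 1))) ≠ ⊤ :=
    ENNReal.mul_ne_top (ENNReal.rpow_ne_top_of_nonneg (by positivity) (by norm_num)) (by simp)
  rw [tsum_congr fun j : ℕ => (lintegral_const_mul (2 ^ (j * (q + 1))) (hball j)).symm, ← lintegral_tsum fun j => ((hball j).const_mul _).aemeasurable, gagliardoEnergy,
    ← lintegral_const_mul' _ _ hK]
  refine lintegral_mono fun u => ?_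
  rw [← lintegral_const_mul' _ _ hK]
  refine le_trans (le_of_eq ?_) (lintegral_mono fun v => tsum_indicator_closedBall_le hq φ u v)
  rw [lintegral_tsum fun j => ((hm u j).const_mul _).aemeasurable]
  refine tsum_congr fun j => ?_
  rw [lintegral_const_mul _ (hm u j), ballEnergy,
    lintegral_indicator isClosed_closedBall.measurableSet]

/-! ### From the Gagliardo integral to the diameter sum -/

/-- A homeomorphism carries the frontier of the ball to the frontier of its image, and the former
lies in the metric sphere. Beyond continuity, this is all that the implication uses about φ. -/
theorem Homeomorph.ediam_image_closedBall_le {X Y : Type*} [MetricSpace X] [MetricSpace Y]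
    (φ : X ≃ₜ Y) {δ : ℝ≥0∞}
    (hδ : ∀ A : Set Y, Metric.ediam A < δ → Metric.ediam A ≤ Metric.ediam (frontier A)) {x : X}
    {r t : ℝ} (hrt : r ≤ t) (ht : Metric.ediam (φ '' Metric.closedBall x t) < δ) :
    Metric.ediam (φ '' Metric.closedBall x r) ≤ Metric.ediam (φ '' Metric.sphere x t) :=
  calc Metric.ediam (φ '' Metric.closedBall x r) ≤ Metric.ediam (φ '' Metric.closedBall x t) :=
        Metric.ediam_mono (image_mono (Metric.closedBall_subset_closedBall hrt))
    _ ≤ Metric.ediam (frontier (φ '' Metric.closedBall x t)) := hδ _ ht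
    _ ≤ _ := by
        rw [← φ.image_frontier]
        exact Metric.ediam_mono (image_mono Metric.frontier_closedBall_subset_sphere)

/-- Multiples of the side lengths `2⁻ⁿ` are eventually small. -/
theorem exists_two_inv_pow_mul_le {ρ : ℝ} (hρ : 0 < ρ) (A : ℝ) (hA : 0 < A) :
    ∃ k₀ : ℕ, ∀ n, k₀ ≤ n → A * 2⁻¹ ^ n ≤ ρ := by
  obtain ⟨n, hn⟩ := exists_pow_lt_of_lt_one (show 0 < ρ / A by positivity)
    (show (2⁻¹ : ℝ) < 1 by norm_num)
  refine ⟨n, fun m hm => ?_⟩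
  have h1 : (2⁻¹ : ℝ) ^ m ≤ 2⁻¹ ^ n := pow_le_pow_of_le_one (by norm_num) (by norm_num) hm
  rw [lt_div_iff₀ hA] at hn
  nlinarith

open Metric in
/-- On a compact set, the images of sufficiently small balls have small diameter. -/
theorem exists_forall_ediam_image_closedBall_lt {X Y : Type*} [MetricSpace X] [MetricSpace Y]
    {φ : X → Y} (hφ : Continuous φ) {Ω Ω' : Set X} (hΩ' : IsCompact Ω') {ρ : ℝ} (hρ : 0 < ρ)
    (hsub : ∀ x ∈ Ω, closedBall x ρ ⊆ Ω') {δ : ℝ≥0∞} (hδ : 0 < δ) :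
    ∃ r > 0, ∀ x ∈ Ω, ediam (φ '' closedBall x r) < δ := by
  obtain ⟨δ', hδ'0, hδ'⟩ := exists_between hδ
  obtain ⟨η, hη, h⟩ := uniformContinuousOn_iff.1
    (hΩ'.uniformContinuousOn_of_continuous hφ.continuousOn) (min 1 δ').toReal
    (ENNReal.toReal_pos (by simp [hδ'0.ne']) (by simp))
  refine ⟨min ρ (η / 3), lt_min hρ (by positivity), fun x hx => lt_of_le_of_lt ?_ hδ'⟩
  refine ediam_le ?_
  rintro _ ⟨y, hy, rfl⟩ _ ⟨z, hz, rfl⟩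
  have hy' := mem_closedBall.1 (closedBall_subset_closedBall (min_le_right ρ (η / 3)) hy)
  have hz' := mem_closedBall.1 (closedBall_subset_closedBall (min_le_right ρ (η / 3)) hz)
  have := h y (hsub x hx (closedBall_subset_closedBall (min_le_left _ _) hy)) z
    (hsub x hx (closedBall_subset_closedBall (min_le_left _ _) hz))
    (by linarith [dist_triangle_right y z x])
  rw [edist_dist]
  refine (ENNReal.ofReal_le_of_le_toReal this.le).trans (min_le_right _ _)

/-- Lets the estimates start at a generation fine enough for the images to be small. -/
theorem ENNReal.tsum_subtype_one_le_lt_top {f : ℕ → ℝ≥0∞} (hf : ∀ k, f k ≠ ⊤) (n : ℕ)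
    (h : ∑' k, f (k + n) < ⊤) : ∑' k : {k : ℕ // 1 ≤ k}, f k < ⊤ := by
  refine (ENNReal.tsum_comp_le_tsum_of_injective Subtype.val_injective f).trans_lt ?_
  rw [← ENNReal.summable.sum_add_tsum_nat_add' (k := n)]
  exact ENNReal.add_lt_top.2 ⟨ENNReal.sum_lt_top.2 fun k _ => (hf k).lt_top, h⟩

open Metric in
/-- The dyadic diameter sum of a homeomorphism is finite if its Gagliardo integral is. The space
`X` is Ahlfors `2`-regular, and small sets in `Y` have the same diameter as their frontier. -/
theorem diameterSum_lt_top_of_gagliardoEnergy_lt_top {X Y : Type*} [MetricSpace X]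
    [MeasurableSpace X] [BorelSpace X] [SecondCountableTopology X] [MetricSpace Y]
    {μ : Measure X} [SFinite μ] {c : ℝ≥0∞} (hc : c ≠ 0)
    (hlow : ∀ x (j : ℕ), c * ENNReal.ofReal (2⁻¹ ^ j) ^ 2 ≤ μ (closedBall x (2⁻¹ ^ j)))
    (hfin : ∀ x r, μ (closedBall x r) ≠ ⊤) {Ω Ω' : Set X} (hΩ' : IsCompact Ω') {ρ : ℝ}
    (hρ : 0 < ρ) (hsub : ∀ x ∈ Ω, closedBall x ρ ⊆ Ω') {δ : ℝ≥0∞} (hδ : 0 < δ)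
    (hY : ∀ A : Set Y, ediam A < δ → ediam A ≤ ediam (frontier A))
    {ι : ℕ → Type} [∀ k, Fintype (ι k)] {Q : ∀ k, ι k → Set X} {p : ∀ k, ι k → X}
    (hQ : IsDyadicCovering Ω Q p) {q : ℝ} (hq : 2 < q) (φ : X ≃ₜ Y)
    (hE : gagliardoEnergy (μ.restrict Ω') q φ < ⊤) : diameterSum Q q φ < ⊤ := by
  classical
  have hφ := φ.continuous
  have hq0 : 0 < q := by linarith
  have hcover := hQ.center_mem
  obtain ⟨D, -, hD⟩ := hQ.exists_subset_closedBall
  -- With 2^d > D, a square of generation n + d lies in the ball of radius 2⁻ⁿ about its centre. All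
  -- estimates compare generation n + d with scale n.
  obtain ⟨d, hd⟩ := pow_unbounded_of_one_lt D (show (1 : ℝ) < 2 by norm_num)
  obtain ⟨M, hM⟩ := hQ.exists_ncard_le (8 * 2 ^ d)
  obtain ⟨r, hr, hrδ⟩ := exists_forall_ediam_image_closedBall_lt hφ hΩ' hρ hsub hδ
  -- 16 = 8 + 8: the point `u` ranges over a ball of radius 8·2⁻ⁿ, and its ball energy reaches
  -- another 8·2⁻ⁿ. The factor 2 in the next line comes from the largest sphere radius.
  obtain ⟨k₁, hk₁⟩ := exists_two_inv_pow_mul_le hρ 16 (by norm_num)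
  obtain ⟨k₂, hk₂⟩ := exists_two_inv_pow_mul_le hr 2 (by norm_num)
  set k₀ := max k₁ k₂ with hk₀
  have hscale : ∀ n : ℕ, (2 : ℝ) ^ d * 2⁻¹ ^ (n + d) = 2⁻¹ ^ n := fun n => by
    rw [pow_add, mul_left_comm, ← mul_pow]
    norm_num
  set ν := μ.restrict Ω' with hν
  -- The averaged estimate decays like 2^(-i(q-2)); the telescoping weight spends half of this rate
  -- and the other half makes the sum over i converge.
  set ε := (q - 2) / 2 with hε
  set W : ℕ → ℝ≥0∞ := fun j => ∫⁻ u, ballEnergy ν q φ (8 * 2⁻¹ ^ j) u ∂ν with hW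
  set K₁ : ℝ≥0∞ := 2 ^ q * (∑' i : ℕ, (2 : ℝ≥0∞) ^ (-(i * (ε / q)))) ^ q with hK₁
  set K₂ : ℝ≥0∞ := 2 ^ (q - 1) * 2 * c⁻¹ ^ 2 * 16 * M with hK₂
  have hlocal : ∀ n, k₀ ≤ n → ∀ m : ι (n + d), ∀ i : ℕ,
      ∫⁻ u in closedBall (p (n + d) m) (8 * 2⁻¹ ^ n), ballEnergy μ q φ (8 * 2⁻¹ ^ (n + i)) u ∂μ ≤
        ∫⁻ u, (closedBall (p (n + d) m) (8 * 2⁻¹ ^ n)).indicator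
          (ballEnergy ν q φ (8 * 2⁻¹ ^ (n + i))) u ∂ν := by
    intro n hn m i
    have h16 := hk₁ n ((le_max_left _ _).trans hn)
    have hpΩ := hsub _ (hQ.subset _ _ (hcover (n + d) m))
    have h1 : (2⁻¹ : ℝ) ^ (n + i) ≤ 2⁻¹ ^ n :=
      pow_le_pow_of_le_one (by norm_num) (by norm_num) (by omega)
    have h2 : (0 : ℝ) < 2⁻¹ ^ n := by positivity
    have hb : closedBall (p (n + d) m) (8 * 2⁻¹ ^ n) ⊆ Ω' :=
      (closedBall_subset_closedBall (by linarith)).trans hpΩ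
    rw [lintegral_indicator isClosed_closedBall.measurableSet, hν,
      Measure.restrict_restrict isClosed_closedBall.measurableSet, inter_eq_self_of_subset_left hb]
    refine setLIntegral_mono' isClosed_closedBall.measurableSet fun u hu => ?_
    rw [ballEnergy, ballEnergy, Measure.restrict_restrict isClosed_closedBall.measurableSet,
      inter_eq_self_of_subset_left]
    refine subset_trans ?_ hpΩ
    rw [mem_closedBall] at hu
    exact closedBall_subset_closedBall' (by linarith)
  have hoverlap : ∀ n, k₀ ≤ n → ∀ i : ℕ,
      ∑ m, ∫⁻ u in closedBall (p (n + d) m) (8 * 2⁻¹ ^ n),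
        ballEnergy μ q φ (8 * 2⁻¹ ^ (n + i)) u ∂μ ≤ M * W (n + i) := by
    intro n hn i
    refine (Finset.sum_le_sum fun m _ => hlocal n hn m i).trans ?_
    rw [← lintegral_finsetSum _ fun m _ => (measurable_ballEnergy hφ _).indicator
      isClosed_closedBall.measurableSet, hW,
      ← lintegral_const_mul _ (measurable_ballEnergy hφ _)]
    refine lintegral_mono fun u => ?_
    simp only [indicator_apply]
    rw [← Finset.sum_filter, Finset.sum_const, nsmul_eq_mul]
    gcongr
    refine le_trans ?_ (hM (n + d) u)
    rw [← Set.ncard_coe_finset]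
    refine Set.ncard_le_ncard (fun m hm => ?_) (Set.toFinite _)
    simp only [Finset.coe_filter, Finset.mem_univ, true_and, mem_ofPred_eq] at hm
    refine ⟨p (n + d) m, hcover _ m, ?_⟩
    rw [mul_assoc, hscale]
    exact mem_closedBall_comm.1 hm
  have hgen : ∀ n, k₀ ≤ n → ∑ m, ediam (φ '' Q (n + d) m) ^ q ≤
      K₁ * K₂ * ∑' i : ℕ, 2 ^ (i * ε) * 2 ^ (n : ℝ) * 2 ^ (3 * ((n + i : ℕ) : ℝ)) * W (n + i) := by
    intro n hn
    have hone : ∀ m, ediam (φ '' Q (n + d) m) ^ q ≤ 2 ^ (n : ℝ) * (K₁ * ∑' i : ℕ, 2 ^ (i * ε) *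
        (2 ^ (q - 1) * 2 * (c * ENNReal.ofReal (2⁻¹ ^ (n + i)) ^ 2)⁻¹ ^ 2 *
        (ENNReal.ofReal (2 * (8 * 2⁻¹ ^ (n + i))) *
          ∫⁻ u in closedBall (p (n + d) m) (8 * 2⁻¹ ^ n),
            ballEnergy μ q φ (8 * 2⁻¹ ^ (n + i)) u ∂μ))) := by
      intro m
      have hb := ediam_image_closedBall_rpow_le (q := q) (by linarith) hφ hc hlow hfin n
        (p (n + d) m) ε fun t ht => φ.ediam_image_closedBall_le hY ht.1 ((ediam_mono (image_mono
          (closedBall_subset_closedBall (ht.2.trans (hk₂ n ((le_max_right _ _).trans hn)))))).trans_lt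
            (hrδ _ (hQ.subset _ _ (hcover _ m))))
      rw [ENNReal.ofReal_two_inv_pow] at hb
      have hQb : Q (n + d) m ⊆ closedBall (p (n + d) m) (2⁻¹ ^ n) := by
        refine (hD _ m).trans (closedBall_subset_closedBall ?_)
        rw [← hscale n]
        gcongr
      calc ediam (φ '' Q (n + d) m) ^ q
          ≤ ediam (φ '' closedBall (p (n + d) m) (2⁻¹ ^ n)) ^ q :=
            ENNReal.rpow_le_rpow (ediam_mono (image_mono hQb)) hq0.le
        _ = 2 ^ (n : ℝ) * (2 ^ (-(n : ℝ)) *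
              ediam (φ '' closedBall (p (n + d) m) (2⁻¹ ^ n)) ^ q) := by
            rw [← mul_assoc, ← ENNReal.two_rpow_add, add_neg_cancel, ENNReal.rpow_zero, one_mul]
        _ ≤ _ := by gcongr
    refine (Finset.sum_le_sum fun m _ => hone m).trans ?_
    rw [← Finset.mul_sum, ← Finset.mul_sum,
      ← Summable.tsum_finsetSum fun _ _ => ENNReal.summable, ← ENNReal.tsum_mul_left,
      ← ENNReal.tsum_mul_left, ← ENNReal.tsum_mul_left]
    refine ENNReal.tsum_le_tsum fun i => ?_
    rw [← Finset.mul_sum, ← Finset.mul_sum, ← Finset.mul_sum]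
    -- Two inverse ball measures give 2^(4(n+i)), and integration over the radius takes one factor
    -- 2^(n+i) back.
    have hconst : (c * ENNReal.ofReal (2⁻¹ ^ (n + i)) ^ 2)⁻¹ ^ 2 *
        ENNReal.ofReal (2 * (8 * 2⁻¹ ^ (n + i))) =
        c⁻¹ ^ 2 * 16 * 2 ^ (3 * ((n + i : ℕ) : ℝ)) := by
      rw [← mul_assoc, ENNReal.ofReal_mul (by norm_num), ENNReal.ofReal_two_inv_pow,
        ENNReal.mul_inv (Or.inr (by finiteness)) (Or.inr (by positivity)), mul_pow,
        ← ENNReal.rpow_mul_natCast, ← ENNReal.rpow_neg, ← ENNReal.rpow_mul_natCast]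
      have : (2 : ℝ≥0∞) ^ (-(-((n + i : ℕ) : ℝ) * (2 : ℕ)) * (2 : ℕ)) * 2 ^ (-((n + i : ℕ) : ℝ)) =
          2 ^ (3 * ((n + i : ℕ) : ℝ)) := by
        rw [← ENNReal.two_rpow_add]
        congr 1
        push_cast
        ring
      rw [← this]
      norm_num
      ring
    calc _ = 2 ^ (n : ℝ) * (K₁ * (2 ^ (i * ε) * (2 ^ (q - 1) * 2 *
            ((c * ENNReal.ofReal (2⁻¹ ^ (n + i)) ^ 2)⁻¹ ^ 2 *
              ENNReal.ofReal (2 * (8 * 2⁻¹ ^ (n + i)))) *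
            ∑ m, ∫⁻ u in closedBall (p (n + d) m) (8 * 2⁻¹ ^ n),
              ballEnergy μ q φ (8 * 2⁻¹ ^ (n + i)) u ∂μ))) := by ring
      _ ≤ 2 ^ (n : ℝ) * (K₁ * (2 ^ (i * ε) * (2 ^ (q - 1) * 2 *
            (c⁻¹ ^ 2 * 16 * 2 ^ (3 * ((n + i : ℕ) : ℝ))) * (M * W (n + i))))) := by
          rw [hconst]
          gcongr
          exact hoverlap n hn i
      _ = _ := by ring
  have hfinite : ∀ k : ℕ, (2 : ℝ≥0∞) ^ ((k : ℝ) * (q - 3)) * ∑ j, ediam (φ '' Q k j) ^ q ≠ ⊤ := by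
    intro k
    refine ENNReal.mul_ne_top (by simp) ?_
    refine ENNReal.sum_ne_top.2 fun j _ => ENNReal.rpow_ne_top_of_nonneg hq0.le ?_
    have : Q k j ⊆ Ω' := fun x hx => hsub x (hQ.subset k j hx) (mem_closedBall_self hρ.le)
    exact ne_top_of_le_ne_top (hΩ'.image hφ).isBounded.ediam_ne_top (ediam_mono (image_mono this))
  refine ENNReal.tsum_subtype_one_le_lt_top hfinite (k₀ + d) ?_
  have hterm : ∀ k : ℕ,
      (2 : ℝ≥0∞) ^ (((k + (k₀ + d) : ℕ) : ℝ) * (q - 3)) *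
          ∑ j, ediam (φ '' Q (k + (k₀ + d)) j) ^ q ≤
        2 ^ (d * (q - 3)) * (K₁ * K₂) * ∑' i : ℕ, 2 ^ (-(i * ε)) *
          (2 ^ (((k + (k₀ + i) : ℕ) : ℝ) * (q + 1)) * W (k + (k₀ + i))) := by
    intro k
    have hg := hgen (k + k₀) (by omega)
    rw [add_assoc] at hg
    refine (mul_le_mul_right hg _).trans (le_of_eq ?_)
    rw [← ENNReal.tsum_mul_left, ← ENNReal.tsum_mul_left, ← ENNReal.tsum_mul_left]
    refine tsum_congr fun i => ?_
    -- Writing j for the scale index `k + k₀ + i`, the exponents combine to j(q + 1) - i(q - 2) +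
    -- iε, up to the shift by `d`, and the part in i equals -iε.
    have hexp : (2 : ℝ≥0∞) ^ (((k + (k₀ + d) : ℕ) : ℝ) * (q - 3)) * (2 ^ (i * ε) *
        2 ^ ((k + k₀ : ℕ) : ℝ) * 2 ^ (3 * ((k + k₀ + i : ℕ) : ℝ))) =
        2 ^ (d * (q - 3)) * (2 ^ (-(i * ε)) * 2 ^ (((k + (k₀ + i) : ℕ) : ℝ) * (q + 1))) := by
      simp only [← ENNReal.two_rpow_add]
      congr 1
      rw [hε]
      push_cast
      ring
    calc _ = (2 : ℝ≥0∞) ^ (((k + (k₀ + d) : ℕ) : ℝ) * (q - 3)) * (2 ^ (i * ε) *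
          2 ^ ((k + k₀ : ℕ) : ℝ) * 2 ^ (3 * ((k + k₀ + i : ℕ) : ℝ))) * (K₁ * K₂) *
            W (k + (k₀ + i)) := by
          rw [add_assoc k k₀ i]
          ring
      _ = _ := by
          rw [hexp]
          ring
  have hsum : ∑' k : ℕ, ∑' i : ℕ, (2 : ℝ≥0∞) ^ (-(i * ε)) *
      (2 ^ (((k + (k₀ + i) : ℕ) : ℝ) * (q + 1)) * W (k + (k₀ + i))) ≤
      (∑' i : ℕ, (2 : ℝ≥0∞) ^ (-(i * ε))) *
        (2 ^ (q + 1) * ENNReal.ofReal (8⁻¹ ^ (-(q + 1))) * gagliardoEnergy ν q φ) := by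
    -- For fixed i the sum over generations is a shifted piece of the full sum over scales, bounded
    -- independently of i.
    rw [ENNReal.tsum_comm, ← ENNReal.tsum_mul_right]
    refine ENNReal.tsum_le_tsum fun i => ?_
    rw [ENNReal.tsum_mul_left]
    gcongr
    refine le_trans ?_ (tsum_lintegral_ballEnergy_le hq0 hφ)
    exact ENNReal.tsum_comp_le_tsum_of_injective (add_left_injective (k₀ + i))
      fun j : ℕ => (2 : ℝ≥0∞) ^ (j * (q + 1)) * W j
  have hε0 : 0 < ε := by rw [hε]; linarith
  have hK₁t : K₁ ≠ ⊤ := ENNReal.mul_ne_top (ENNReal.rpow_ne_top_of_nonneg hq0.le (by norm_num))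
    (ENNReal.rpow_ne_top_of_nonneg hq0.le
      (ENNReal.tsum_two_rpow_neg_ne_top (div_pos hε0 hq0)))
  have hK₂t : K₂ ≠ ⊤ := by
    have : c⁻¹ ≠ ⊤ := ENNReal.inv_ne_top.2 hc
    have : (2 : ℝ≥0∞) ^ (q - 1) ≠ ⊤ := ENNReal.rpow_ne_top_of_nonneg (by linarith) (by norm_num)
    finiteness
  have hK₃t : (2 : ℝ≥0∞) ^ (d * (q - 3)) ≠ ⊤ := by simp
  have hK₄t : (2 : ℝ≥0∞) ^ (q + 1) ≠ ⊤ := by simp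
  have hεt := ENNReal.tsum_two_rpow_neg_ne_top hε0
  calc _ ≤ _ := ENNReal.tsum_le_tsum hterm
    _ ≤ 2 ^ (d * (q - 3)) * (K₁ * K₂) * ((∑' i : ℕ, (2 : ℝ≥0∞) ^ (-(i * ε))) *
        (2 ^ (q + 1) * ENNReal.ofReal (8⁻¹ ^ (-(q + 1))) * gagliardoEnergy ν q φ)) := by
        rw [ENNReal.tsum_mul_left]
        gcongr
    _ < ⊤ := (ENNReal.mul_ne_top (ENNReal.mul_ne_top hK₃t (ENNReal.mul_ne_top hK₁t hK₂t))
        (ENNReal.mul_ne_top hεt (ENNReal.mul_ne_top (ENNReal.mul_ne_top hK₄t (by simp))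
          hE.ne))).lt_top

/-! ### Diameter of a set and of its frontier -/

/-- Otherwise the interior of `A` and the complement of its closure would separate `K`. -/
theorem IsPreconnected.exists_mem_frontier {Y : Type*} [TopologicalSpace Y] {K A : Set Y}
    (hK : IsPreconnected K) {y w : Y} (hy : y ∈ K) (hyA : y ∈ closure A) (hw : w ∈ K)
    (hwA : w ∉ closure A) : ∃ z ∈ K, z ∈ frontier A := by
  by_contra! h
  have hcov : K ⊆ interior A ∪ (closure A)ᶜ := by
    intro z hz
    by_cases hzA : z ∈ closure A
    · exact Or.inl (by_contra fun hi => h z hz ⟨hzA, hi⟩)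
    · exact Or.inr hzA
  obtain ⟨z, -, hz1, hz2⟩ := hK _ _ isOpen_interior isClosed_closure.isOpen_compl hcov
    ⟨y, hy, by_contra fun hi => h y hy ⟨hyA, hi⟩⟩ ⟨w, hw, hwA⟩
  exact hz2 (interior_subset_closure hz1)

open Metric in
/-- If one can move away from any point `x` starting at any other point `y`, up to distance `δ`
and without coming closer to `x`, then the diameter of a set of diameter less than `δ` is that of
its frontier. -/
theorem ediam_le_ediam_frontier {Y : Type*} [MetricSpace Y] {δ : ℝ≥0∞}
    (h : ∀ x y : Y, x ≠ y → ∃ K, IsPreconnected K ∧ y ∈ K ∧ (∀ z ∈ K, edist x y ≤ edist x z) ∧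
      ∃ w ∈ K, δ ≤ edist x w) {A : Set Y} (hA : ediam A < δ) :
    ediam A ≤ ediam (frontier A) := by
  have key : ∀ x ∈ closure A, ∀ y ∈ closure A, x ≠ y →
      ∃ z ∈ frontier A, edist x y ≤ edist x z := by
    intro x hx y hy hxy
    obtain ⟨K, hK, hyK, hfar, w, hwK, hw⟩ := h x y hxy
    obtain ⟨z, hzK, hz⟩ := hK.exists_mem_frontier hyK hy hwK fun hwA =>
      absurd ((hw.trans (edist_le_ediam_of_mem hx hwA)).trans_eq (ediam_closure A)) hA.not_ge
    exact ⟨z, hz, hfar z hzK⟩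
  refine ediam_le fun x hx y hy => ?_
  rcases eq_or_ne x y with rfl | hxy
  · simp
  -- Pushing `y` away from `x` reaches a frontier point `z`; pushing `x` away from `z` then reaches
  -- a second one, and neither move shortens the distance.
  obtain ⟨z, hz, hxz⟩ := key x (subset_closure hx) y (subset_closure hy) hxy
  have hzx : z ≠ x := by
    rintro rfl
    exact hxy (edist_le_zero.1 (hxz.trans_eq (edist_self _)))
  obtain ⟨z', hz', hzz'⟩ := key z (frontier_subset_closure hz) x (subset_closure hx) hzx
  exact (hxz.trans_eq (edist_comm x z)).trans (hzz'.trans (edist_le_ediam_of_mem hz hz'))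

/-- Move from `y` along the ray pointing away from `x`: the distance to `x` increases without bound.
-/
theorem ediam_le_ediam_frontier_of_normedSpace {E : Type*} [NormedAddCommGroup E]
    [NormedSpace ℝ E] {A : Set E} (hA : Metric.ediam A < 1) :
    Metric.ediam A ≤ Metric.ediam (frontier A) := by
  refine ediam_le_ediam_frontier (fun x y hxy => ?_) hA
  have hd : 0 < ‖y - x‖ := norm_pos_iff.2 (sub_ne_zero.2 hxy.symm)
  have hdist : ∀ t : ℝ, 0 ≤ t → edist x (AffineMap.lineMap x y t) = ENNReal.ofReal (t * ‖y - x‖) :=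
    fun t ht => by
      rw [edist_dist, dist_left_lineMap, Real.norm_of_nonneg ht, dist_comm, dist_eq_norm]
  refine ⟨AffineMap.lineMap x y '' Ici (1 : ℝ), isPreconnected_Ici.image _
    AffineMap.lineMap_continuous.continuousOn, ⟨1, self_mem_Ici, by simp⟩, ?_,
    AffineMap.lineMap x y (1 + 1 / ‖y - x‖), ⟨_, ?_, rfl⟩, ?_⟩
  · rintro _ ⟨t, ht, rfl⟩
    rw [mem_Ici] at ht
    rw [hdist t (by linarith), edist_comm, edist_dist, dist_eq_norm]
    refine ENNReal.ofReal_le_ofReal ?_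
    nlinarith
  · rw [mem_Ici]
    have : 0 < 1 / ‖y - x‖ := by positivity
    linarith
  · rw [hdist _ (by positivity), ENNReal.one_le_ofReal, add_mul, one_div_mul_cancel hd.ne']
    linarith

/-! ### Dyadic squares of the unit square -/

theorem ncard_abs_sub_le (n N : ℕ) (a : ℝ) : {m : Fin n | |(m : ℝ) - a| ≤ N}.ncard ≤ 2 * N + 1 := by
  have hmap : ∀ m ∈ {m : Fin n | |(m : ℝ) - a| ≤ N},
      ((m : ℕ) : ℤ) ∈ (Finset.Icc ⌈a - N⌉ ⌊a + N⌋ : Set ℤ) := by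
    intro m hm
    rw [mem_ofPred_eq, abs_le] at hm
    simp only [Finset.coe_Icc, mem_Icc, Int.ceil_le, Int.le_floor]
    push_cast
    constructor <;> linarith
  refine (Set.ncard_le_ncard_of_injOn (fun m : Fin n => ((m : ℕ) : ℤ)) hmap ?_
    (Finset.finite_toSet _)).trans ?_
  · intro m _ m' _ h
    exact Fin.ext (Int.ofNat_injective h)
  · rw [Set.ncard_coe_finset, Int.card_Icc, Int.ceil_sub_natCast, Int.floor_add_natCast]
    have := Int.floor_le_ceil a
    omega

theorem ncard_forall_abs_sub_le (n N : ℕ) (a : Fin 2 → ℝ) :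
    {m : Fin 2 → Fin n | ∀ i, |(m i : ℝ) - a i| ≤ N}.ncard ≤ (2 * N + 1) ^ 2 := by
  classical
  have h : {m : Fin 2 → Fin n | ∀ i, |(m i : ℝ) - a i| ≤ N} =
      (Fintype.piFinset fun i => {m : Fin n | |(m : ℝ) - a i| ≤ N}.toFinset : Set _) := by
    ext m
    simp
  rw [h, Set.ncard_coe_finset, Fintype.card_piFinset, Fin.prod_univ_two, sq]
  simp only [← Set.ncard_eq_toFinset_card']
  exact Nat.mul_le_mul (ncard_abs_sub_le _ _ _) (ncard_abs_sub_le _ _ _)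

/-- The closed dyadic squares of generation `k` of `[0, 1]²`. -/
def unitDyadicSquare (k : ℕ) (m : Fin 2 → Fin (2 ^ k)) : Set (Fin 2 → ℝ) :=
  {s | ∀ i, s i ∈ Icc (((m i : ℕ) : ℝ) / 2 ^ k) ((((m i : ℕ) : ℝ) + 1) / 2 ^ k)}

/-- The lower left corner of a dyadic square. -/
noncomputable def unitDyadicCorner (k : ℕ) (m : Fin 2 → Fin (2 ^ k)) : Fin 2 → ℝ :=
  fun i => ((m i : ℕ) : ℝ) / 2 ^ k

theorem unitDyadicCorner_mem (k : ℕ) (m : Fin 2 → Fin (2 ^ k)) :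
    unitDyadicCorner k m ∈ unitDyadicSquare k m := fun i =>
  ⟨le_rfl, by unfold unitDyadicCorner; gcongr; linarith⟩

theorem unitDyadicSquare_subset_Icc (k : ℕ) (m : Fin 2 → Fin (2 ^ k)) :
    unitDyadicSquare k m ⊆ {s | ∀ i, s i ∈ Icc (0 : ℝ) 1} := by
  intro s hs i
  have hm : ((m i : ℕ) : ℝ) + 1 ≤ 2 ^ k := by exact_mod_cast (m i).isLt
  refine ⟨le_trans (by positivity) (hs i).1, (hs i).2.trans ?_⟩
  rwa [div_le_one (by positivity)]

theorem dist_le_of_mem_unitDyadicSquare {k : ℕ} {m : Fin 2 → Fin (2 ^ k)} {s t : Fin 2 → ℝ}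
    (hs : s ∈ unitDyadicSquare k m) (ht : t ∈ unitDyadicSquare k m) : dist s t ≤ 2⁻¹ ^ k := by
  refine (dist_pi_le_iff (by positivity)).2 fun i => ?_
  have h : (((m i : ℕ) : ℝ) + 1) / 2 ^ k - ((m i : ℕ) : ℝ) / 2 ^ k = 2⁻¹ ^ k := by
    rw [← sub_div, add_sub_cancel_left, inv_pow, one_div]
  exact (Real.dist_le_of_mem_Icc (hs i) (ht i)).trans_eq h

theorem exists_mem_Icc_div_two_pow (k : ℕ) {t : ℝ} (ht : t ∈ Icc (0 : ℝ) 1) :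
    ∃ m : Fin (2 ^ k), t ∈ Icc (((m : ℕ) : ℝ) / 2 ^ k) ((((m : ℕ) : ℝ) + 1) / 2 ^ k) := by
  have h2 : (0 : ℝ) < 2 ^ k := by positivity
  -- The right endpoint belongs to the last interval, whereas the floor would give the excluded
  -- index 2^k.
  rcases ht.2.eq_or_lt with rfl | h1
  · refine ⟨⟨2 ^ k - 1, by have := Nat.two_pow_pos k; omega⟩, ?_⟩
    rw [mem_Icc, div_le_iff₀ h2, le_div_iff₀ h2]
    push_cast [Nat.cast_sub (Nat.one_le_two_pow (n := k))]
    constructor <;> linarith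
  · refine ⟨⟨⌊t * 2 ^ k⌋₊, ?_⟩, ?_⟩
    · rw [Nat.floor_lt (by have := ht.1; positivity)]
      push_cast
      nlinarith
    · rw [mem_Icc, div_le_iff₀ h2, le_div_iff₀ h2]
      exact ⟨Nat.floor_le (by have := ht.1; positivity), (Nat.lt_floor_add_one _).le⟩

theorem exists_mem_unitDyadicSquare (k : ℕ) {s : Fin 2 → ℝ} (hs : ∀ i, s i ∈ Icc (0 : ℝ) 1) :
    ∃ m, s ∈ unitDyadicSquare k m := by
  choose m hm using fun i => exists_mem_Icc_div_two_pow k (hs i)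
  exact ⟨m, hm⟩

/-- Under an expanding chart a small ball meets boundedly many images of dyadic squares. -/
theorem exists_ncard_image_unitDyadicSquare_le {X : Type*} [MetricSpace X]
    {ψ : (Fin 2 → ℝ) → X} {a : ℝ} (ha : 0 < a) (hψ : ∀ s t, a * dist s t ≤ dist (ψ s) (ψ t))
    (A : ℝ) : ∃ M : ℕ, ∀ k x, {m : Fin 2 → Fin (2 ^ k) |
      (ψ '' unitDyadicSquare k m ∩ Metric.closedBall x (A * 2⁻¹ ^ k)).Nonempty}.ncard ≤ M := by
  -- After rescaling by 2^k, points of two squares meeting the ball are within 2A/a of each other;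
  -- the 1 passes from a point of a square to its corner.
  obtain ⟨N, hN⟩ := exists_nat_ge (2 * A / a + 1)
  refine ⟨(2 * N + 1) ^ 2, fun k x => ?_⟩
  rcases Set.eq_empty_or_nonempty {m : Fin 2 → Fin (2 ^ k) |
    (ψ '' unitDyadicSquare k m ∩ Metric.closedBall x (A * 2⁻¹ ^ k)).Nonempty} with h | h
  · rw [h, Set.ncard_empty]
    exact Nat.zero_le _
  obtain ⟨-, -, ⟨s, -, rfl⟩, hs⟩ := h
  refine (Set.ncard_le_ncard ?_ (Set.toFinite _)).trans
    (ncard_forall_abs_sub_le (2 ^ k) N fun i => s i * 2 ^ k)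
  rintro m ⟨-, ⟨t, htm, rfl⟩, ht⟩ i
  have h2 : (0 : ℝ) < 2 ^ k := by positivity
  rw [Metric.mem_closedBall] at hs ht
  have h1 : dist t s ≤ 2 * A / a * (2 ^ k)⁻¹ := by
    rw [inv_pow] at hs ht
    have := (hψ t s).trans (dist_triangle_right _ _ x)
    rw [div_mul_eq_mul_div, le_div_iff₀ ha]
    linarith
  have h3 : |t i - s i| ≤ 2 * A / a * (2 ^ k)⁻¹ := (dist_le_pi_dist t s i).trans h1
  have h4 : |t i * 2 ^ k - s i * 2 ^ k| ≤ 2 * A / a := by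
    rw [← sub_mul, abs_mul, abs_of_pos h2]
    calc _ ≤ 2 * A / a * (2 ^ k)⁻¹ * 2 ^ k := by gcongr
      _ = _ := by rw [mul_assoc, inv_mul_cancel₀ h2.ne', mul_one]
  have h5 := htm i
  rw [mem_Icc, div_le_iff₀ h2, le_div_iff₀ h2] at h5
  rw [abs_le] at h4 ⊢
  constructor <;> linarith [h4.1, h4.2, h5.1, h5.2]

theorem EuclideanSpace.dist_ofLp_le {n : ℕ} (x y : EuclideanSpace ℝ (Fin n)) :
    dist (WithLp.ofLp x) (WithLp.ofLp y) ≤ dist x y := by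
  simpa using (PiLp.lipschitzWith_ofLp 2 fun _ : Fin n => ℝ).dist_le_mul x y

theorem EuclideanSpace.exists_dist_le_mul_dist_ofLp (n : ℕ) :
    ∃ L : ℝ, 0 < L ∧ ∀ x y : EuclideanSpace ℝ (Fin n),
      dist x y ≤ L * dist (WithLp.ofLp x) (WithLp.ofLp y) := by
  set K := (Fintype.card (Fin n) : NNReal) ^ (1 / (2 : ℝ≥0∞)).toReal
  refine ⟨K + 1, by positivity, fun x y => ?_⟩
  refine ((PiLp.antilipschitzWith_ofLp 2 fun _ : Fin n => ℝ).le_mul_dist x y).trans ?_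
  gcongr
  exact le_add_of_nonneg_right zero_le_one

/-! ### The plane -/

/-- The affine chart from `[0, 1]²` onto `[-R, R]²`. -/
noncomputable def planeChart (R : ℝ) (s : Fin 2 → ℝ) : EuclideanSpace ℝ (Fin 2) :=
  WithLp.toLp 2 fun i => -R + 2 * R * s i

theorem dist_ofLp_planeChart {R : ℝ} (hR : 0 < R) (s t : Fin 2 → ℝ) :
    dist (WithLp.ofLp (planeChart R s)) (WithLp.ofLp (planeChart R t)) = 2 * R * dist s t := by
  have h : ∀ i, dist (-R + 2 * R * s i) (-R + 2 * R * t i) = 2 * R * dist (s i) (t i) := fun i => by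
    rw [dist_add_left, Real.dist_eq, ← mul_sub, abs_mul, abs_of_pos (by positivity), Real.dist_eq]
  refine le_antisymm ((dist_pi_le_iff (by positivity)).2 fun i => ?_) ?_
  · refine (h i).trans_le ?_
    gcongr
    exact dist_le_pi_dist s t i
  · rw [← le_div_iff₀' (by positivity)]
    refine (dist_pi_le_iff (by positivity)).2 fun i => ?_
    rw [le_div_iff₀' (by positivity), ← h i]
    exact dist_le_pi_dist (WithLp.ofLp (planeChart R s)) (WithLp.ofLp (planeChart R t)) i

theorem planeChart_surjective {R : ℝ} (hR : 0 < R) : Function.Surjective (planeChart R) := by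
  intro x
  refine ⟨fun i => (x i + R) / (2 * R), ?_⟩
  ext i
  simp only [planeChart]
  field_simp
  ring

theorem planeChart_apply (R : ℝ) (s : Fin 2 → ℝ) (i : Fin 2) :
    planeChart R s i = -R + 2 * R * s i := rfl

theorem planeChart_mem_planeSquare {R : ℝ} (hR : 0 < R) {s : Fin 2 → ℝ} :
    planeChart R s ∈ planeSquare R ↔ ∀ i, s i ∈ Icc (0 : ℝ) 1 := by
  refine forall_congr' fun i => ?_
  simp only [planeChart_apply, mem_Icc]
  constructor <;> rintro ⟨h1, h2⟩ <;> constructor <;> nlinarith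

theorem planeDyadicSquare_eq_image {R : ℝ} (hR : 0 < R) (k : ℕ) (m : Fin 2 → Fin (2 ^ k)) :
    planeDyadicSquare R k m = planeChart R '' unitDyadicSquare k m := by
  have h : ∀ s, planeChart R s ∈ planeDyadicSquare R k m ↔ s ∈ unitDyadicSquare k m := by
    intro s
    refine forall_congr' fun i => ?_
    simp only [planeChart_apply, mem_Icc]
    rw [add_le_add_iff_left, add_le_add_iff_left, mul_le_mul_iff_right₀ (by positivity),
      mul_le_mul_iff_right₀ (by positivity)]
  ext x
  obtain ⟨s, rfl⟩ := planeChart_surjective hR x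
  rw [h]
  refine ⟨mem_image_of_mem _, ?_⟩
  rintro ⟨t, ht, hts⟩
  rwa [← (h s), ← hts, h t]

theorem isDyadicCovering_planeDyadicSquare {R : ℝ} (hR : 0 < R) :
    IsDyadicCovering (planeSquare R) (planeDyadicSquare R)
      fun k m => planeChart R (unitDyadicCorner k m) where
  subset k m := by
    rw [planeDyadicSquare_eq_image hR]
    rintro _ ⟨s, hs, rfl⟩
    exact (planeChart_mem_planeSquare hR).2 (unitDyadicSquare_subset_Icc k m hs)
  center_mem k m := by
    rw [planeDyadicSquare_eq_image hR]
    exact mem_image_of_mem _ (unitDyadicCorner_mem k m)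
  exists_subset_closedBall := by
    obtain ⟨L, hL, h⟩ := EuclideanSpace.exists_dist_le_mul_dist_ofLp 2
    refine ⟨L * (2 * R), by positivity, fun k m => ?_⟩
    rw [planeDyadicSquare_eq_image hR]
    rintro _ ⟨s, hs, rfl⟩
    refine (h _ _).trans ?_
    rw [dist_ofLp_planeChart hR, ← mul_assoc]
    gcongr
    exact dist_le_of_mem_unitDyadicSquare hs (unitDyadicCorner_mem k m)
  exists_mem k x hx := by
    obtain ⟨s, rfl⟩ := planeChart_surjective hR x
    obtain ⟨m, hm⟩ := exists_mem_unitDyadicSquare k ((planeChart_mem_planeSquare hR).1 hx)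
    exact ⟨m, (planeDyadicSquare_eq_image hR k m).symm ▸ mem_image_of_mem _ hm⟩
  exists_ncard_le A := by
    obtain ⟨M, hM⟩ := exists_ncard_image_unitDyadicSquare_le (ψ := planeChart R)
      (show 0 < 2 * R by positivity)
      (fun s t => (dist_ofLp_planeChart hR s t).symm.trans_le (EuclideanSpace.dist_ofLp_le _ _)) A
    refine ⟨M, fun k x => ?_⟩
    simp only [planeDyadicSquare_eq_image hR]
    exact hM k x

theorem convex_planeSquare (R : ℝ) : Convex ℝ (planeSquare R) := by
  intro x hx y hy a b ha hb hab i
  exact convex_Icc (-R) R (hx i) (hy i) ha hb hab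

theorem isCompact_planeSquare (R : ℝ) : IsCompact (planeSquare R) := by
  have h : planeSquare R = (EuclideanSpace.equiv (Fin 2) ℝ).toHomeomorph ⁻¹'
      (univ.pi fun _ => Icc (-R) R) := by
    ext x
    exact mem_univ_pi.symm
  rw [h, Homeomorph.isCompact_preimage]
  exact isCompact_univ_pi fun _ => isCompact_Icc

theorem planeSquare_mono {R R' : ℝ} (h : R ≤ R') : planeSquare R ⊆ planeSquare R' :=
  fun _ hx i => Icc_subset_Icc (neg_le_neg h) h (hx i)

theorem closedBall_subset_planeSquare {R r : ℝ} {x : EuclideanSpace ℝ (Fin 2)}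
    (hx : x ∈ planeSquare R) : Metric.closedBall x r ⊆ planeSquare (R + r) := by
  intro y hy i
  have h := (dist_le_pi_dist _ _ i).trans ((EuclideanSpace.dist_ofLp_le y x).trans hy)
  rw [Real.dist_eq, abs_le] at h
  have := hx i
  constructor <;> linarith [this.1, this.2, h.1, h.2]

theorem gagliardoEnergy_mono {X Y : Type*} [MetricSpace X] [MeasurableSpace X] [MetricSpace Y]
    {μ ν : Measure X} (h : μ ≤ ν) (q : ℝ) (φ : X → Y) :
    gagliardoEnergy μ q φ ≤ gagliardoEnergy ν q φ :=
  lintegral_mono' h fun _ => lintegral_mono' h le_rfl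

theorem gagliardoEnergy_planeSquare_lt_top {N q : ℝ} (hN : 0 < N) (hq : 0 < q)
    {φ : EuclideanSpace ℝ (Fin 2) → EuclideanSpace ℝ (Fin 2)} (hφ : Continuous φ)
    (h : diameterSum (planeDyadicSquare N) q φ < ⊤) :
    gagliardoEnergy (volume.restrict (planeSquare N)) q φ < ⊤ := by
  have hc := isCompact_planeSquare N
  have : IsFiniteMeasure (volume.restrict (planeSquare N)) :=
    isFiniteMeasure_restrict.2 hc.measure_ne_top
  refine gagliardoEnergy_lt_top_of_diameterSum_lt_top (Ω := planeSquare N)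
    (C := ENNReal.ofReal Real.pi)
    (ae_restrict_mem hc.measurableSet) (by simp) (fun x r => ?_)
    (isDyadicCovering_planeDyadicSquare hN) (fun x hx y hy => ⟨segment ℝ x y, ?_, ?_, ?_, ?_⟩)
    hq hφ (hc.image hφ).isBounded.ediam_ne_top h
  · refine (Measure.restrict_apply_le _ _).trans_eq ?_
    rw [EuclideanSpace.volume_closedBall_fin_two, mul_comm]
  · refine subset_inter ((convex_planeSquare N).segment_subset hx hy) ?_
    refine (convex_closedBall x (dist x y)).segment_subset (Metric.mem_closedBall_self dist_nonneg) ?_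
    rw [Metric.mem_closedBall, dist_comm]
  · exact (convex_segment x y).isPreconnected
  · exact left_mem_segment ℝ x y
  · exact right_mem_segment ℝ x y

/-- The energy on a square enlarged by 1 is used because balls centred in [-N, N]² leave that
square. This is harmless since the hypothesis in the plane is assumed for every R. -/
theorem diameterSum_planeDyadicSquare_lt_top {N q : ℝ} (hN : 0 < N) (hq : 2 < q)
    (φ : EuclideanSpace ℝ (Fin 2) ≃ₜ EuclideanSpace ℝ (Fin 2))
    (h : gagliardoEnergy (volume.restrict (planeSquare (N + 1))) q φ < ⊤) :
    diameterSum (planeDyadicSquare N) q φ < ⊤ := by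
  refine diameterSum_lt_top_of_gagliardoEnergy_lt_top (μ := volume) (c := ENNReal.ofReal Real.pi)
    (by simp [Real.pi_pos]) (fun x j => ?_) (fun x r => measure_closedBall_lt_top.ne)
    (isCompact_planeSquare (N + 1)) one_pos (fun x hx => closedBall_subset_planeSquare hx)
    one_pos (fun A hA => ediam_le_ediam_frontier_of_normedSpace hA)
    (isDyadicCovering_planeDyadicSquare hN) hq φ h
  rw [EuclideanSpace.volume_closedBall_fin_two, mul_comm]

theorem gagliardoEnergy_plane_iff {q : ℝ} (hq : 2 < q)
    (φ : EuclideanSpace ℝ (Fin 2) ≃ₜ EuclideanSpace ℝ (Fin 2)) :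
    (∀ R : ℝ, 0 < R → gagliardoEnergy (volume.restrict (planeSquare R)) q φ < ⊤) ↔
      ∀ N : ℕ, 1 ≤ N → diameterSum (planeDyadicSquare (N : ℝ)) q φ < ⊤ := by
  constructor
  · intro h N hN
    have hN' : (0 : ℝ) < N := by exact_mod_cast hN
    exact diameterSum_planeDyadicSquare_lt_top hN' hq φ (h _ (by positivity))
  · intro h R hR
    obtain ⟨N, hN⟩ := exists_nat_ge R
    have hN' : (0 : ℝ) < N := hR.trans_le hN
    exact (gagliardoEnergy_mono (Measure.restrict_mono (planeSquare_mono hN) le_rfl) q φ).trans_lt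
      (gagliardoEnergy_planeSquare_lt_top hN' (by linarith) φ.continuous
        (h N (by exact_mod_cast hN')))

/-! ### Great circles on the sphere -/

/-- Supplies the second axis of a great circle. The case `w = 0` occurs for equal or antipodal
points, where any unit vector orthogonal to `x` serves. -/
theorem exists_norm_eq_one_inner_eq_zero_eq_norm_smul {x w : EuclideanSpace ℝ (Fin 3)}
    (hx : x ≠ 0) (hxw : inner ℝ x w = 0) : ∃ v, ‖v‖ = 1 ∧ inner ℝ x v = 0 ∧ w = ‖w‖ • v := by
  have hnormalize : ∀ u : EuclideanSpace ℝ (Fin 3), u ≠ 0 → inner ℝ x u = 0 →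
      ‖‖u‖⁻¹ • u‖ = 1 ∧ inner ℝ x (‖u‖⁻¹ • u) = 0 := fun u hu hxu =>
    ⟨by rw [norm_smul, norm_inv, norm_norm, inv_mul_cancel₀ (norm_ne_zero_iff.2 hu)], by rw [inner_smul_right, hxu, mul_zero]⟩
  rcases eq_or_ne w 0 with rfl | hw
  · have : Fact (Module.finrank ℝ (EuclideanSpace ℝ (Fin 3)) = 2 + 1) := ⟨by simp⟩
    have hfr := Submodule.finrank_orthogonal_span_singleton (𝕜 := ℝ) (n := 2) hx
    obtain ⟨u, hu, hu0⟩ := Submodule.exists_mem_ne_zero_of_ne_bot (p := (ℝ ∙ x)ᗮ) fun h => by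
      rw [h, finrank_bot] at hfr
      omega
    obtain ⟨h1, h2⟩ := hnormalize u hu0 (Submodule.mem_orthogonal_singleton_iff_inner_right.1 hu)
    exact ⟨_, h1, h2, by simp⟩
  · obtain ⟨h1, h2⟩ := hnormalize w hw hxw
    exact ⟨_, h1, h2, by rw [smul_inv_smul₀ (norm_ne_zero_iff.2 hw)]⟩

/-- A great circle through `x` and `y`, parametrized by the angle from `x`. -/
theorem UnitSphere.exists_greatCircle (x y : UnitSphere) :
    ∃ g : ℝ → UnitSphere, Continuous g ∧ (∀ θ, dist x (g θ) ^ 2 = 2 - 2 * Real.cos θ) ∧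
      g 0 = x ∧ ∃ θ₀ ∈ Icc 0 Real.pi, g θ₀ = y := by
  have hx : ‖x.1‖ = 1 := norm_eq_of_mem_sphere x
  have hy : ‖y.1‖ = 1 := norm_eq_of_mem_sphere y
  have hxx : inner ℝ x.1 x.1 = (1 : ℝ) := by rw [real_inner_self_eq_norm_sq, hx, one_pow]
  set c : ℝ := inner ℝ x.1 y.1 with hc
  have hc1 : -1 ≤ c ∧ c ≤ 1 := by
    have := abs_real_inner_le_norm x.1 y.1
    rw [hx, hy, mul_one, abs_le] at this
    exact this
  have hx0 : x.1 ≠ 0 := norm_ne_zero_iff.1 (by rw [hx]; exact one_ne_zero)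
  have hw : inner ℝ x.1 (y.1 - c • x.1) = 0 := by
    rw [inner_sub_right, inner_smul_right, hxx, mul_one, hc, sub_self]
  obtain ⟨v, hv, hxv, hwv⟩ := exists_norm_eq_one_inner_eq_zero_eq_norm_smul hx0 hw
  have hmem : ∀ θ : ℝ, Real.cos θ • x.1 + Real.sin θ • v ∈
      Metric.sphere (0 : EuclideanSpace ℝ (Fin 3)) 1 := by
    intro θ
    rw [mem_sphere_zero_iff_norm, ← sq_eq_sq₀ (norm_nonneg _) zero_le_one, one_pow,
      norm_add_sq_real, norm_smul, norm_smul, hx, hv, inner_smul_left, inner_smul_right, hxv]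
    simp
  have hwn : ‖y.1 - c • x.1‖ = √(1 - c ^ 2) := by
    rw [← Real.sqrt_sq (norm_nonneg (y.1 - c • x.1)), norm_sub_sq_real, hy, norm_smul, hx,
      inner_smul_right, real_inner_comm, ← hc, mul_one, Real.norm_eq_abs, sq_abs]
    congr 1
    ring
  refine ⟨fun θ => ⟨_, hmem θ⟩, Continuous.subtype_mk (by fun_prop) _, fun θ => ?_,
    Subtype.ext (by simp), Real.arccos c, ⟨Real.arccos_nonneg c, Real.arccos_le_pi c⟩,
    Subtype.ext ?_⟩
  · rw [Subtype.dist_eq, dist_eq_norm, norm_sub_sq_real, hx,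
      mem_sphere_zero_iff_norm.1 (hmem θ), inner_add_right, inner_smul_right, inner_smul_right,
      hxx, hxv]
    ring
  · simp only [Real.cos_arccos hc1.1 hc1.2, Real.sin_arccos]
    rw [← hwn, ← hwv, add_sub_cancel]

theorem dist_le_dist_of_cos_le_cos {x z w : UnitSphere} {a b : ℝ}
    (hz : dist x z ^ 2 = 2 - 2 * Real.cos a) (hw : dist x w ^ 2 = 2 - 2 * Real.cos b)
    (h : Real.cos b ≤ Real.cos a) : dist x z ≤ dist x w := by
  rw [← sq_le_sq₀ dist_nonneg dist_nonneg, hz, hw]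
  linarith

/-- The arc of the great circle from `x` to `y` works, since the distance from `x` increases with
the angle on [0, π]. -/
theorem UnitSphere.exists_isPreconnected_subset_closedBall (x y : UnitSphere) :
    ∃ K ⊆ Metric.closedBall x (dist x y), IsPreconnected K ∧ x ∈ K ∧ y ∈ K := by
  obtain ⟨g, hg, hdist, h0, θ₀, hθ₀, hy⟩ := exists_greatCircle x y
  refine ⟨g '' Icc 0 θ₀, ?_, isPreconnected_Icc.image g hg.continuousOn,
    ⟨0, left_mem_Icc.2 hθ₀.1, h0⟩, ⟨θ₀, right_mem_Icc.2 hθ₀.1, hy⟩⟩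
  rintro _ ⟨θ, hθ, rfl⟩
  rw [Metric.mem_closedBall', ← hy]
  exact dist_le_dist_of_cos_le_cos (hdist θ) (hdist θ₀)
    (Real.cos_le_cos_of_nonneg_of_le_pi hθ.1 hθ₀.2 hθ.2)

/-- Continue the great circle from `y` to the antipode of `x`, which has distance 2 from `x`. -/
theorem UnitSphere.ediam_le_ediam_frontier {A : Set UnitSphere} (hA : Metric.ediam A < 1) :
    Metric.ediam A ≤ Metric.ediam (frontier A) := by
  refine _root_.ediam_le_ediam_frontier (fun x y _ => ?_) hA
  obtain ⟨g, hg, hdist, h0, θ₀, hθ₀, hy⟩ := exists_greatCircle x y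
  refine ⟨g '' Icc θ₀ Real.pi, isPreconnected_Icc.image g hg.continuousOn,
    ⟨θ₀, left_mem_Icc.2 hθ₀.2, hy⟩, ?_, g Real.pi, mem_image_of_mem g (right_mem_Icc.2 hθ₀.2), ?_⟩
  · rintro _ ⟨θ, hθ, rfl⟩
    rw [edist_dist, edist_dist, ← hy]
    exact ENNReal.ofReal_le_ofReal (dist_le_dist_of_cos_le_cos (hdist θ₀) (hdist θ)
      (Real.cos_le_cos_of_nonneg_of_le_pi hθ₀.1 hθ.2 hθ.1))
  · rw [edist_dist, ENNReal.one_le_ofReal]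
    have := hdist Real.pi
    rw [Real.cos_pi] at this
    nlinarith [dist_nonneg (x := x) (y := g Real.pi)]

/-! ### The boundary of the cube -/

/-- The point with coordinates `s` in the face `x i = e` of the unit cube. -/
noncomputable def facePoint (f : Fin 3 × Fin 2) (s : Fin 2 → ℝ) : EuclideanSpace ℝ (Fin 3) :=
  WithLp.toLp 2 (f.1.insertNth (α := fun _ => ℝ) ((f.2 : ℕ) : ℝ) s)

theorem dist_ofLp_facePoint (f : Fin 3 × Fin 2) (s t : Fin 2 → ℝ) :
    dist (WithLp.ofLp (facePoint f s)) (WithLp.ofLp (facePoint f t)) = dist s t := by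
  refine (Fin.dist_insertNth_insertNth (α := fun _ => ℝ) f.1 _ _ s t).trans ?_
  rw [dist_self, max_eq_right dist_nonneg]

theorem facePoint_apply_self (f : Fin 3 × Fin 2) (s : Fin 2 → ℝ) :
    facePoint f s f.1 = ((f.2 : ℕ) : ℝ) :=
  Fin.insertNth_apply_same (α := fun _ => ℝ) f.1 _ s

theorem facePoint_apply_succAbove (f : Fin 3 × Fin 2) (s : Fin 2 → ℝ) (l : Fin 2) :
    facePoint f s (f.1.succAbove l) = s l :=
  Fin.insertNth_apply_succAbove (α := fun _ => ℝ) f.1 _ s l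

theorem eq_facePoint {f : Fin 3 × Fin 2} {x : EuclideanSpace ℝ (Fin 3)}
    (h : x f.1 = ((f.2 : ℕ) : ℝ)) : x = facePoint f fun l => x (f.1.succAbove l) := by
  ext i
  revert i
  rw [Fin.forall_iff_succAbove f.1]
  exact ⟨by rw [h, facePoint_apply_self], fun l => by rw [facePoint_apply_succAbove]⟩

theorem cubeDyadicSquare_eq_image (k : ℕ) (i : Fin 3) (e : Fin 2) (m : Fin 2 → Fin (2 ^ k)) :
    cubeDyadicSquare k (i, e, m) = facePoint (i, e) '' unitDyadicSquare k m := by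
  ext x
  constructor
  · rintro ⟨h1, h2⟩
    exact ⟨_, h2, (eq_facePoint (f := (i, e)) h1).symm⟩
  · rintro ⟨s, hs, rfl⟩
    refine ⟨facePoint_apply_self (i, e) s, fun l => ?_⟩
    rw [facePoint_apply_succAbove (i, e) s l]
    exact hs l

theorem mem_frontier_unitCube_iff {x : EuclideanSpace ℝ (Fin 3)} :
    x ∈ frontier unitCube ↔ ∃ (f : Fin 3 × Fin 2) (s : Fin 2 → ℝ),
      (∀ l, s l ∈ Icc (0 : ℝ) 1) ∧ facePoint f s = x := by
  have h : unitCube = (EuclideanSpace.equiv (Fin 3) ℝ).toHomeomorph ⁻¹'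
      (univ.pi fun _ => Icc (0 : ℝ) 1) := by
    ext x
    exact mem_univ_pi.symm
  have hcl : IsClosed (univ.pi fun _ : Fin 3 => Icc (0 : ℝ) 1) :=
    isClosed_set_pi fun _ _ => isClosed_Icc
  rw [h, ← Homeomorph.preimage_frontier, hcl.frontier_eq, interior_pi_set finite_univ]
  simp only [interior_Icc]
  have hx : (EuclideanSpace.equiv (Fin 3) ℝ).toHomeomorph x = WithLp.ofLp x := rfl
  rw [mem_preimage, hx, Set.mem_sdiff, mem_univ_pi, mem_univ_pi]
  constructor
  · rintro ⟨h1, h2⟩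
    push Not at h2
    obtain ⟨i, hi⟩ := h2
    have hxi : x i = 0 ∨ x i = 1 := by
      by_contra! hne
      exact hi ⟨(h1 i).1.lt_of_ne hne.1.symm, (h1 i).2.lt_of_ne hne.2⟩
    rcases hxi with hxi | hxi
    · exact ⟨(i, 0), fun l => x (i.succAbove l), fun l => h1 _,
        (eq_facePoint (f := (i, 0)) (by simpa using hxi)).symm⟩
    · exact ⟨(i, 1), fun l => x (i.succAbove l), fun l => h1 _,
        (eq_facePoint (f := (i, 1)) (by simpa using hxi)).symm⟩
  · rintro ⟨f, s, hs, rfl⟩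
    have hf : ((f.2 : ℕ) : ℝ) = 0 ∨ ((f.2 : ℕ) : ℝ) = 1 := by
      obtain ⟨i, e⟩ := f
      fin_cases e <;> simp
    refine ⟨(Fin.forall_iff_succAbove f.1).2 ⟨?_, fun l => ?_⟩, fun hi => ?_⟩
    · rw [facePoint_apply_self]
      rcases hf with hf | hf <;> simp [hf]
    · rw [facePoint_apply_succAbove]
      exact hs l
    · have := hi f.1
      rw [facePoint_apply_self] at this
      rcases hf with hf | hf <;> simp [hf] at this

/-- A bi-Lipschitz map of the space that takes the unit cube onto the unit ball takes the boundary
of the cube onto the unit sphere. -/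
theorem IsBiLipschitz.image_frontier_unitCube
    {Φ : EuclideanSpace ℝ (Fin 3) → EuclideanSpace ℝ (Fin 3)} (hΦ : IsBiLipschitz Φ)
    (hcube : Φ '' unitCube = Metric.closedBall 0 1) :
    Φ '' frontier unitCube = Metric.sphere 0 1 := by
  obtain ⟨hbij, c, C, hc, hC, h⟩ := hΦ
  have hlip : LipschitzWith C.toNNReal Φ := LipschitzWith.of_dist_le_mul fun x y => by
    rw [Real.coe_toNNReal _ hC.le]
    exact (h x y).2
  have hanti : AntilipschitzWith (c⁻¹).toNNReal Φ := AntilipschitzWith.of_le_mul_dist fun x y => by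
    rw [Real.coe_toNNReal _ (by positivity), ← div_eq_inv_mul, le_div_iff₀' hc]
    exact (h x y).1
  let e : EuclideanSpace ℝ (Fin 3) ≃ₜ EuclideanSpace ℝ (Fin 3) :=
    (Equiv.ofBijective Φ hbij).toHomeomorphOfIsInducing
      (hanti.isUniformEmbedding hlip.uniformContinuous).isEmbedding.isInducing
  have he : ⇑e = Φ := rfl
  rw [← he, e.image_frontier, he, hcube, frontier_closedBall _ one_ne_zero]

/-! ### The induced decomposition and the surface measure of the sphere -/

section SphereChart

variable {Φ : EuclideanSpace ℝ (Fin 3) → EuclideanSpace ℝ (Fin 3)}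

theorem IsBiLipschitz.exists_facePoint_bounds (hΦ : IsBiLipschitz Φ) :
    ∃ a L : ℝ, 0 < a ∧ 0 < L ∧ ∀ f s t, a * dist s t ≤ dist (Φ (facePoint f s)) (Φ (facePoint f t)) ∧
      dist (Φ (facePoint f s)) (Φ (facePoint f t)) ≤ L * dist s t := by
  obtain ⟨-, c, C, hc, hC, h⟩ := hΦ
  obtain ⟨L, hL, hdist⟩ := EuclideanSpace.exists_dist_le_mul_dist_ofLp 3
  refine ⟨c, C * L, hc, by positivity, fun f s t => ⟨le_trans ?_ (h _ _).1, (h _ _).2.trans ?_⟩⟩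
  · rw [← dist_ofLp_facePoint f s t]
    gcongr
    exact EuclideanSpace.dist_ofLp_le _ _
  · rw [mul_assoc, ← dist_ofLp_facePoint f s t]
    gcongr
    exact hdist _ _

theorem IsBiLipschitz.map_facePoint_mem_sphere (hΦ : IsBiLipschitz Φ)
    (hcube : Φ '' unitCube = Metric.closedBall 0 1) (f : Fin 3 × Fin 2) {s : Fin 2 → ℝ}
    (hs : ∀ l, s l ∈ Icc (0 : ℝ) 1) : Φ (facePoint f s) ∈ Metric.sphere 0 1 :=
  hΦ.image_frontier_unitCube hcube ▸
    mem_image_of_mem Φ (mem_frontier_unitCube_iff.2 ⟨f, s, hs, rfl⟩)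

theorem IsBiLipschitz.exists_map_facePoint_eq (hΦ : IsBiLipschitz Φ)
    (hcube : Φ '' unitCube = Metric.closedBall 0 1) (x : UnitSphere) :
    ∃ (f : Fin 3 × Fin 2) (s : Fin 2 → ℝ), (∀ l, s l ∈ Icc (0 : ℝ) 1) ∧ Φ (facePoint f s) = x := by
  obtain ⟨y, hy, hyx⟩ := (hΦ.image_frontier_unitCube hcube).symm.subset x.2
  obtain ⟨f, s, hs, rfl⟩ := mem_frontier_unitCube_iff.1 hy
  exact ⟨f, s, hs, hyx⟩

theorem mem_sphereDyadicSquare_iff {k : ℕ} {j : Fin 3 × Fin 2 × (Fin 2 → Fin (2 ^ k))}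
    {x : UnitSphere} : x ∈ sphereDyadicSquare Φ k j ↔
      ∃ s ∈ unitDyadicSquare k j.2.2, Φ (facePoint (j.1, j.2.1) s) = x := by
  obtain ⟨i, e, m⟩ := j
  rw [sphereDyadicSquare, cubeDyadicSquare_eq_image, mem_preimage, image_image, mem_image]

theorem isDyadicCovering_sphereDyadicSquare (hΦ : IsBiLipschitz Φ)
    (hcube : Φ '' unitCube = Metric.closedBall 0 1) :
    IsDyadicCovering univ (sphereDyadicSquare Φ) fun k j =>
      ⟨Φ (facePoint (j.1, j.2.1) (unitDyadicCorner k j.2.2)),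
        hΦ.map_facePoint_mem_sphere hcube _
          (unitDyadicSquare_subset_Icc k _ (unitDyadicCorner_mem k j.2.2))⟩ where
  subset k j := subset_univ _
  center_mem k j := mem_sphereDyadicSquare_iff.2 ⟨_, unitDyadicCorner_mem k j.2.2, rfl⟩
  exists_subset_closedBall := by
    obtain ⟨a, L, -, hL, h⟩ := hΦ.exists_facePoint_bounds
    refine ⟨L, hL.le, fun k j x hx => ?_⟩
    obtain ⟨s, hs, hsx⟩ := mem_sphereDyadicSquare_iff.1 hx
    rw [Metric.mem_closedBall, Subtype.dist_eq, ← hsx]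
    refine (h _ _ _).2.trans ?_
    gcongr
    exact dist_le_of_mem_unitDyadicSquare hs (unitDyadicCorner_mem k j.2.2)
  exists_mem k x _ := by
    obtain ⟨f, s, hs, hsx⟩ := hΦ.exists_map_facePoint_eq hcube x
    obtain ⟨m, hm⟩ := exists_mem_unitDyadicSquare k hs
    exact ⟨(f.1, f.2, m), mem_sphereDyadicSquare_iff.2 ⟨s, hm, hsx⟩⟩
  exists_ncard_le A := by
    obtain ⟨a, L, ha, -, h⟩ := hΦ.exists_facePoint_bounds
    choose M hM using fun f : Fin 3 × Fin 2 =>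
      exists_ncard_image_unitDyadicSquare_le (ψ := fun s => Φ (facePoint f s)) ha
        (fun s t => (h f s t).1) A
    refine ⟨∑ f, M f, fun k x => ?_⟩
    -- Each face is a separate chart, so the overlap bounds of the six faces add up.
    have hsub : {j | (sphereDyadicSquare Φ k j ∩ Metric.closedBall x (A * 2⁻¹ ^ k)).Nonempty} ⊆
        ⋃ f : Fin 3 × Fin 2, (fun m => (f.1, f.2, m)) '' {m : Fin 2 → Fin (2 ^ k) |
          ((fun s => Φ (facePoint f s)) '' unitDyadicSquare k m ∩
            Metric.closedBall x.1 (A * 2⁻¹ ^ k)).Nonempty} := by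
      rintro ⟨i, e, m⟩ ⟨y, hy, hyx⟩
      obtain ⟨s, hs, hsy⟩ := mem_sphereDyadicSquare_iff.1 hy
      refine mem_iUnion.2 ⟨(i, e), m, ⟨y.1, ⟨s, hs, hsy⟩, hyx⟩, rfl⟩
    calc _ ≤ _ := Set.ncard_le_ncard hsub (Set.toFinite _)
      _ ≤ _ := Set.ncard_iUnion_le_of_fintype _
      _ ≤ _ := Finset.sum_le_sum fun f _ => (Set.ncard_image_le (Set.toFinite _)).trans (hM f k x.1)

/-- The parameter square carries the sup metric, for which Hausdorff and Lebesgue measure agree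
without a normalising factor; Lipschitz bounds for the charts then transfer areas to the sphere. -/
theorem hausdorffMeasure_two_eq_volume :
    (Measure.hausdorffMeasure 2 : Measure (Fin 2 → ℝ)) = volume := by
  rw [← hausdorffMeasure_pi_real (ι := Fin 2), Fintype.card_fin, Nat.cast_ofNat]

theorem UnitSphere.hausdorffMeasure_image_val (A : Set UnitSphere) :
    Measure.hausdorffMeasure 2 ((↑) '' A : Set (EuclideanSpace ℝ (Fin 3))) =
      (Measure.hausdorffMeasure 2 : Measure UnitSphere) A :=
  isometry_subtype_coe.hausdorffMeasure_image (Or.inl zero_le_two) A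

/-- The surface measure of a spherical ball is at most a constant times the square of its
radius. -/
theorem IsBiLipschitz.exists_hausdorffMeasure_closedBall_le (hΦ : IsBiLipschitz Φ)
    (hcube : Φ '' unitCube = Metric.closedBall 0 1) :
    ∃ C : ℝ≥0∞, C ≠ ⊤ ∧ ∀ (x : UnitSphere) (r : ℝ),
      (Measure.hausdorffMeasure 2 : Measure UnitSphere) (Metric.closedBall x r) ≤
        C * ENNReal.ofReal r ^ 2 := by
  obtain ⟨a, L, ha, hL, h⟩ := hΦ.exists_facePoint_bounds
  -- Six faces; in each, the preimage of the ball lies in a sup-norm ball of radius 2r/a, a square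
  -- of side 4r/a.
  refine ⟨6 * ((L.toNNReal : ℝ≥0∞) ^ (2 : ℝ) * ENNReal.ofReal (4 / a) ^ 2),
    by finiteness, fun x r => ?_⟩
  rcases lt_or_ge r 0 with hr | hr
  · simp [Metric.closedBall_eq_empty.2 hr]
  set T : Fin 3 × Fin 2 → Set (Fin 2 → ℝ) := fun f =>
    {s | Φ (facePoint f s) ∈ Metric.closedBall x.1 r} with hT
  have hsub : ((↑) '' Metric.closedBall x r : Set (EuclideanSpace ℝ (Fin 3))) ⊆
      ⋃ f, (fun s => Φ (facePoint f s)) '' T f := by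
    rintro _ ⟨y, hy, rfl⟩
    obtain ⟨f, s, -, hsy⟩ := hΦ.exists_map_facePoint_eq hcube y
    refine mem_iUnion.2 ⟨f, s, ?_, hsy⟩
    rw [hT, mem_ofPred_eq, hsy]
    exact hy
  have hvol : ∀ f, volume (T f) ≤ ENNReal.ofReal (4 / a) ^ 2 * ENNReal.ofReal r ^ 2 := by
    intro f
    rcases (T f).eq_empty_or_nonempty with h0 | ⟨s, hs⟩
    · simp [h0]
    have hTs : T f ⊆ Metric.closedBall s (2 * r / a) := by
      intro t ht
      have h1 := (h f t s).1.trans (dist_triangle_right _ _ x.1)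
      have h2 : dist (Φ (facePoint f t)) x.1 ≤ r := ht
      have h3 : dist (Φ (facePoint f s)) x.1 ≤ r := hs
      rw [Metric.mem_closedBall, le_div_iff₀ ha]
      linarith
    refine (measure_mono hTs).trans_eq ?_
    rw [Real.volume_pi_closedBall _ (by positivity), Fintype.card_fin, ← mul_pow,
      ← ENNReal.ofReal_mul (by positivity), ENNReal.ofReal_pow (by positivity)]
    congr 2
    ring
  have hlip : ∀ f, LipschitzWith L.toNNReal fun s => Φ (facePoint f s) := fun f =>
    LipschitzWith.of_dist_le_mul fun s t => by
      rw [Real.coe_toNNReal _ hL.le]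
      exact (h f s t).2
  rw [← UnitSphere.hausdorffMeasure_image_val]
  calc _ ≤ _ := measure_mono hsub
    _ ≤ _ := measure_iUnion_fintype_le _ _
    _ ≤ ∑ _f : Fin 3 × Fin 2, (L.toNNReal : ℝ≥0∞) ^ (2 : ℝ) *
          (ENNReal.ofReal (4 / a) ^ 2 * ENNReal.ofReal r ^ 2) := by
        refine Finset.sum_le_sum fun f _ =>
          ((hlip f).hausdorffMeasure_image_le zero_le_two _).trans ?_
        rw [hausdorffMeasure_two_eq_volume]
        gcongr
        exact hvol f
    _ = _ := by
        rw [Finset.sum_const, Finset.card_univ, Fintype.card_prod, Fintype.card_fin,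
          Fintype.card_fin, nsmul_eq_mul]
        norm_num
        ring

theorem exists_Icc_subset {p ρ : ℝ} (hp : p ∈ Icc (0 : ℝ) 1) (h0 : 0 ≤ ρ) (h1 : ρ ≤ 2⁻¹) :
    ∃ b, Icc b (b + ρ) ⊆ Icc 0 1 ∩ Icc (p - ρ) (p + ρ) := by
  rcases le_total p 2⁻¹ with hp' | hp'
  · exact ⟨p, fun t ht => ⟨⟨hp.1.trans ht.1, by linarith [ht.2]⟩, by linarith [ht.1], ht.2⟩⟩
  · refine ⟨p - ρ, fun t ht => ?_⟩
    rw [sub_add_cancel] at ht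
    exact ⟨⟨by linarith [ht.1], ht.2.trans hp.2⟩, ht.1, by linarith [ht.2]⟩

/-- The surface measure of a spherical ball of radius at most one is at least a constant times the
square of its radius. -/
theorem IsBiLipschitz.exists_le_hausdorffMeasure_closedBall (hΦ : IsBiLipschitz Φ)
    (hcube : Φ '' unitCube = Metric.closedBall 0 1) :
    ∃ c : ℝ≥0∞, c ≠ 0 ∧ ∀ (x : UnitSphere) (r : ℝ), 0 ≤ r → r ≤ 1 → c * ENNReal.ofReal r ^ 2 ≤
      (Measure.hausdorffMeasure 2 : Measure UnitSphere) (Metric.closedBall x r) := by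
  obtain ⟨a, L, ha, hL, h⟩ := hΦ.exists_facePoint_bounds
  -- K ≤ 1/2 lets a square of side K r fit into the face next to `p` for every r ≤ 1, and L K ≤ 1
  -- keeps its image in the ball of radius r.
  set K : ℝ := (2 * max 1 L)⁻¹ with hK
  have hK0 : 0 < K := by positivity
  have hK2 : K ≤ 2⁻¹ := inv_anti₀ (by norm_num) (by linarith [le_max_left 1 L])
  have hKL : L * K ≤ 1 := by
    rw [hK, ← div_eq_mul_inv, div_le_one (by positivity)]
    linarith [le_max_right 1 L]
  set α : ℝ≥0∞ := ((a⁻¹).toNNReal : ℝ≥0∞) ^ (2 : ℝ) with hα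
  have hα0 : α ≠ 0 := by
    have : 0 < a⁻¹ := by positivity
    simpa [hα] using ha
  have hαt : α ≠ ⊤ := by finiteness
  refine ⟨α⁻¹ * ENNReal.ofReal K ^ 2, ?_, fun x r hr hr1 => ?_⟩
  · exact mul_ne_zero (ENNReal.inv_ne_zero.2 hαt) (by positivity)
  obtain ⟨f, p, hp, hpx⟩ := hΦ.exists_map_facePoint_eq hcube x
  have hρ : K * r ≤ 2⁻¹ := by nlinarith
  choose b hb using fun l => exists_Icc_subset (hp l) (by positivity) hρ
  set B : Set (Fin 2 → ℝ) := univ.pi fun l => Icc (b l) (b l + K * r) with hB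
  have hvol : volume B = ENNReal.ofReal K ^ 2 * ENNReal.ofReal r ^ 2 := by
    rw [hB, volume_pi_pi, Fin.prod_univ_two, Real.volume_Icc, Real.volume_Icc, ← mul_pow,
      ← ENNReal.ofReal_mul hK0.le, sq]
    simp only [add_sub_cancel_left]
  have hsub : (fun s => Φ (facePoint f s)) '' B ⊆ (↑) '' Metric.closedBall x r := by
    rintro _ ⟨s, hs, rfl⟩
    have hs' := fun l => hb l (hs l (mem_univ l))
    refine ⟨⟨_, hΦ.map_facePoint_mem_sphere hcube f fun l => (hs' l).1⟩, ?_, rfl⟩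
    rw [Metric.mem_closedBall, Subtype.dist_eq, ← hpx]
    have hsp : dist s p ≤ K * r := (dist_pi_le_iff (by positivity)).2 fun l => by
      rw [Real.dist_eq, abs_le]
      have := (hs' l).2
      constructor <;> linarith [this.1, this.2]
    calc _ ≤ L * dist s p := (h f s p).2
      _ ≤ L * (K * r) := by gcongr
      _ ≤ r := by nlinarith
  have hanti : AntilipschitzWith (a⁻¹).toNNReal fun s => Φ (facePoint f s) :=
    AntilipschitzWith.of_le_mul_dist fun s t => by
      rw [Real.coe_toNNReal _ (by positivity), ← div_eq_inv_mul, le_div_iff₀' ha]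
      exact (h f s t).1
  have hle := hanti.le_hausdorffMeasure_image zero_le_two B
  rw [hausdorffMeasure_two_eq_volume, hvol] at hle
  rw [← UnitSphere.hausdorffMeasure_image_val, mul_assoc]
  refine le_trans ?_ (measure_mono hsub)
  rw [mul_comm, ← div_eq_mul_inv]
  exact ENNReal.div_le_of_le_mul' hle

theorem IsBiLipschitz.gagliardoEnergy_sphere_iff (hΦ : IsBiLipschitz Φ)
    (hcube : Φ '' unitCube = Metric.closedBall 0 1) {q : ℝ} (hq : 2 < q)
    (φ : UnitSphere ≃ₜ UnitSphere) :
    gagliardoEnergy (Measure.hausdorffMeasure 2 : Measure UnitSphere) q φ < ⊤ ↔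
      diameterSum (sphereDyadicSquare Φ) q φ < ⊤ := by
  obtain ⟨C, hC, hup⟩ := hΦ.exists_hausdorffMeasure_closedBall_le hcube
  obtain ⟨c, hc, hlow⟩ := hΦ.exists_le_hausdorffMeasure_closedBall hcube
  have hfin : ∀ (x : UnitSphere) r,
      (Measure.hausdorffMeasure 2 : Measure UnitSphere) (Metric.closedBall x r) ≠ ⊤ := fun x r =>
    ne_top_of_le_ne_top (by finiteness) (hup x r)
  have hfinite : IsFiniteMeasure (Measure.hausdorffMeasure 2 : Measure UnitSphere) := by
    obtain ⟨x₀⟩ : Nonempty UnitSphere :=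
      ⟨⟨_, hΦ.map_facePoint_mem_sphere hcube (0, 0) (s := fun _ => 0) (by simp)⟩⟩
    -- The whole sphere is one closed ball, so the upper area bound makes its measure finite.
    refine ⟨(measure_mono fun y _ => ?_).trans_lt (hfin x₀ (Metric.diam (univ : Set UnitSphere))).lt_top⟩
    exact Metric.dist_le_diam_of_mem isCompact_univ.isBounded (mem_univ _) (mem_univ _)
  have hQ := isDyadicCovering_sphereDyadicSquare hΦ hcube
  constructor
  · intro h
    refine diameterSum_lt_top_of_gagliardoEnergy_lt_top
      (μ := (Measure.hausdorffMeasure 2 : Measure UnitSphere)) hc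
      (fun x j => hlow x _ (by positivity) (pow_le_one₀ (by norm_num) (by norm_num))) hfin
      isCompact_univ one_pos (fun _ _ => subset_univ _) one_pos
      (fun A hA => UnitSphere.ediam_le_ediam_frontier hA) hQ hq φ ?_
    rwa [Measure.restrict_univ]
  · intro h
    refine gagliardoEnergy_lt_top_of_diameterSum_lt_top (Filter.Eventually.of_forall mem_univ) hC
      hup hQ (fun x _ y _ => ?_) (by linarith) φ.continuous
      (isCompact_univ.image φ.continuous).isBounded.ediam_ne_top h
    obtain ⟨K, hK, h1, h2, h3⟩ := UnitSphere.exists_isPreconnected_subset_closedBall x y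
    exact ⟨K, subset_inter (subset_univ _) hK, h1, h2, h3⟩

end SphereChart

/-- The surface measure of the sphere is the two-dimensional Hausdorff measure `μH[2]`
(up to a constant factor, which does not affect finiteness). -/
theorem theorem1p1 (q : ℝ) (hq : 2 < q) :
    (∀ Φ : EuclideanSpace ℝ (Fin 3) → EuclideanSpace ℝ (Fin 3),
      IsBiLipschitz Φ → Φ '' unitCube = Metric.closedBall 0 1 →
      ∀ φ : UnitSphere ≃ₜ UnitSphere,
        gagliardoEnergy (Measure.hausdorffMeasure 2 : Measure UnitSphere) q φ < ⊤ ↔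
          diameterSum (sphereDyadicSquare Φ) q φ < ⊤) ∧
    (∀ φ : EuclideanSpace ℝ (Fin 2) ≃ₜ EuclideanSpace ℝ (Fin 2),
      (∀ R : ℝ, 0 < R → gagliardoEnergy (volume.restrict (planeSquare R)) q φ < ⊤) ↔
        ∀ N : ℕ, 1 ≤ N → diameterSum (planeDyadicSquare (N : ℝ)) q φ < ⊤) :=
  ⟨fun _ hΦ hcube φ => hΦ.gagliardoEnergy_sphere_iff hcube hq φ,
    fun φ => gagliardoEnergy_plane_iff hq φ⟩
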